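/- There are a single real-RAM program and constants $C,d$ such that the following holds for all integers $n,k\ge 0$. Let $p_1,\dots,p_n$ be points in the plane in convex position (each is a vertex of the convex hull of all of them; in particular they are distinct), given in arbitrary order, with radii $r_i\ge 0$ and weights $w_i>0$. Let $G$ be the disk graph on the vertices $1,\dots,n$, in which distinct $i,j$ are adjacent iff the closed disks with centers $p_i,p_j$ and radii $r_i,r_j$ intersect. A dominating set of $G$ is a set $S$ of vertices such that every vertex is in $S$ or adjacent to a vertex of $S$; its weight is $\sum_{i\in S}w_i$. On input $n$, $k$, the coordinates of the $p_i$, the $r_i$ and the $w_i$, the program halts within $$C\,k^2n^3\log^2 n$$ steps (with $k$ read as $\max(k,1)$ and $n$ as $\max(n,2)$ in this bound) and either outputs a dominating set of $G$ of size at most $k$ that has minimum weight among all dominating sets of size at most $k$, or reports correctly that $G$ has no dominating set of size at most $k$. Here the real RAM has arrays of integers and arrays of exact real numbers, with indirect addressing. It can add, subtract, multiply, divide and compare integers (with truncated subtraction and division rounded down) and, separately, real numbers; its only real constants are natural numbers, and real numbers cannot be rounded or converted to integers. Every operation, memory access, constant, test and command costs one step. All integers that are stored, and all addresses that are written to, are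 less than $(n+k+2)^d$, i.e. fit in words of $O(\log(n+k+2))$ bits. -/

import Mathlib

/-! ### Disk graphs and dominating sets -/

/-- The disk graph of the disks with centers `p v` and radii `r v`: distinct vertices are adjacent
iff their closed disks intersect. -/
def diskGraph {V : Type*} (p : V → EuclideanSpace ℝ (Fin 2)) (r : V → ℝ) : SimpleGraph V where
  Adj u v := u ≠ v ∧ (Metric.closedBall (p u) (r u) ∩ Metric.closedBall (p v) (r v)).Nonempty
  symm := ⟨fun _ _ h => ⟨h.1.symm, by rw [Set.inter_comm]; exact h.2⟩⟩
  loopless := ⟨fun _ h => h.1 rfl⟩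

/-- `S` is a dominating set of `G`: every vertex lies in `S` or is adjacent to a vertex of `S`. -/
def IsDominatingSet {V : Type*} (G : SimpleGraph V) (S : Finset V) : Prop :=
  ∀ v, v ∈ S ∨ ∃ u ∈ S, G.Adj v u

/-- `S` has minimum total weight among the dominating sets of `G` of size at most `k`. -/
def IsMinWeightDominatingSet {V : Type*} (G : SimpleGraph V) (w : V → ℝ) (k : ℕ)
    (S : Finset V) : Prop :=
  (IsDominatingSet G S ∧ S.card ≤ k) ∧
    ∀ T : Finset V, IsDominatingSet G T → T.card ≤ k → ∑ v ∈ S, w v ≤ ∑ v ∈ T, w v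

/-- A correct answer to the problem of finding a minimum-weight dominating set of size at most `k`:
either such a set, or the report `none`, which is correct iff no dominating set has size
at most `k`. -/
def IsCorrectAnswer {V : Type*} (G : SimpleGraph V) (w : V → ℝ) (k : ℕ) :
    Option (Finset V) → Prop
  | some S => IsMinWeightDominatingSet G w k S
  | none => ∀ T : Finset V, IsDominatingSet G T → ¬ T.card ≤ k

/-! ### The real RAM

A random-access machine with finitely many (those its program mentions) arrays of integer words and
arrays of exact real numbers, all with indirect addressing.  Programs are written as structured
code; every arithmetic operation, comparison, logical connective, memory access and constant costs
one step, and so does every command and every test of a loop.  Integer words and addresses that are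
written to must stay below the word bound `W` (otherwise there is no execution), so that integer
arithmetic cannot be abused.  Real numbers can be added, subtracted, multiplied, divided and
compared; there is no rounding and no conversion of a real number to an integer.  -/

namespace RealRAM

/-- The memory: `nat a i` and `real a i` are the `i`-th cells of the `a`-th integer array and of the
`a`-th real array. -/
structure State where
  nat : ℕ → ℕ → ℕ
  real : ℕ → ℕ → ℝ

/-- Integer expressions. -/
inductive NExp where
  | const (c : ℕ)
  | get (a : ℕ) (i : NExp)
  | add (e f : NExp)
  | sub (e f : NExp)
  | mul (e f : NExp)
  | div (e f : NExp)

/-- The value of an integer expression (truncated subtraction, division rounded down). -/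
def NExp.eval (s : State) : NExp → ℕ
  | .const c => c
  | .get a i => s.nat a (i.eval s)
  | .add e f => e.eval s + f.eval s
  | .sub e f => e.eval s - f.eval s
  | .mul e f => e.eval s * f.eval s
  | .div e f => e.eval s / f.eval s

/-- The number of steps for evaluating an integer expression. -/
def NExp.cost : NExp → ℕ
  | .const _ => 1
  | .get _ i => i.cost + 1
  | .add e f => e.cost + f.cost + 1
  | .sub e f => e.cost + f.cost + 1
  | .mul e f => e.cost + f.cost + 1
  | .div e f => e.cost + f.cost + 1

/-- Real expressions; the only constants are natural numbers. -/
inductive RExp where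
  | const (c : ℕ)
  | get (a : ℕ) (i : NExp)
  | add (e f : RExp)
  | sub (e f : RExp)
  | mul (e f : RExp)
  | div (e f : RExp)

/-- The value of a real expression. -/
noncomputable def RExp.eval (s : State) : RExp → ℝ
  | .const c => (c : ℝ)
  | .get a i => s.real a (i.eval s)
  | .add e f => e.eval s + f.eval s
  | .sub e f => e.eval s - f.eval s
  | .mul e f => e.eval s * f.eval s
  | .div e f => e.eval s / f.eval s

/-- The number of steps for evaluating a real expression. -/
def RExp.cost : RExp → ℕ
  | .const _ => 1
  | .get _ i => i.cost + 1
  | .add e f => e.cost + f.cost + 1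
  | .sub e f => e.cost + f.cost + 1
  | .mul e f => e.cost + f.cost + 1
  | .div e f => e.cost + f.cost + 1

/-- Tests. -/
inductive BExp where
  | natLe (e f : NExp)
  | realLe (e f : RExp)
  | not (b : BExp)
  | and (b c : BExp)

/-- The truth of a test. -/
def BExp.Holds (s : State) : BExp → Prop
  | .natLe e f => e.eval s ≤ f.eval s
  | .realLe e f => e.eval s ≤ f.eval s
  | .not b => ¬ b.Holds s
  | .and b c => b.Holds s ∧ c.Holds s

/-- The number of steps for evaluating a test. -/
def BExp.cost : BExp → ℕ
  | .natLe e f => e.cost + f.cost + 1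
  | .realLe e f => e.cost + f.cost + 1
  | .not b => b.cost + 1
  | .and b c => b.cost + c.cost + 1

/-- Programs. -/
inductive Program where
  | skip
  | natStore (a : ℕ) (i e : NExp)
  | realStore (a : ℕ) (i : NExp) (e : RExp)
  | seq (c d : Program)
  | branch (b : BExp) (c d : Program)
  | loop (b : BExp) (c : Program)

/-- The memory after writing `x` into cell `i` of integer array `a`. -/
def State.setNat (s : State) (a i x : ℕ) : State :=
  { s with nat := Function.update s.nat a (Function.update (s.nat a) i x) }

/-- The memory after writing `x` into cell `i` of real array `a`. -/
noncomputable def State.setReal (s : State) (a i : ℕ) (x : ℝ) : State :=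
  { s with real := Function.update s.real a (Function.update (s.real a) i x) }

/-- `Exec W c s t s'`: with word bound `W`, the program `c` started in memory `s` halts after exactly
`t` steps in memory `s'`. -/
inductive Exec (W : ℕ) : Program → State → ℕ → State → Prop where
  | skip (s : State) : Exec W .skip s 1 s
  | natStore (a : ℕ) (i e : NExp) (s : State) (hi : i.eval s < W) (he : e.eval s < W) :
      Exec W (.natStore a i e) s (i.cost + e.cost + 1) (s.setNat a (i.eval s) (e.eval s))
  | realStore (a : ℕ) (i : NExp) (e : RExp) (s : State) (hi : i.eval s < W) :
      Exec W (.realStore a i e) s (i.cost + e.cost + 1) (s.setReal a (i.eval s) (e.eval s))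
  | seq {c d : Program} {s s' s'' : State} {t t' : ℕ}
      (hc : Exec W c s t s') (hd : Exec W d s' t' s'') :
      Exec W (.seq c d) s (t + t' + 1) s''
  | branchTrue {b : BExp} {c d : Program} {s s' : State} {t : ℕ}
      (hb : b.Holds s) (hc : Exec W c s t s') :
      Exec W (.branch b c d) s (b.cost + t + 1) s'
  | branchFalse {b : BExp} {c d : Program} {s s' : State} {t : ℕ}
      (hb : ¬ b.Holds s) (hd : Exec W d s t s') :
      Exec W (.branch b c d) s (b.cost + t + 1) s'
  | loopTrue {b : BExp} {c : Program} {s s' s'' : State} {t t' : ℕ}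
      (hb : b.Holds s) (hc : Exec W c s t s') (hl : Exec W (.loop b c) s' t' s'') :
      Exec W (.loop b c) s (b.cost + t + t' + 1) s''
  | loopFalse {b : BExp} {c : Program} {s : State} (hb : ¬ b.Holds s) :
      Exec W (.loop b c) s (b.cost + 1) s

/-- The initial memory: `n` and `k` are in cells `0` and `1` of integer array `0`; real arrays
`0`, `1`, `2`, `3` hold the two coordinates of the centers, the radii and the weights; every other
cell is `0`. -/
noncomputable def input (n k : ℕ) (p : Fin n → EuclideanSpace ℝ (Fin 2)) (r w : Fin n → ℝ) :
    State where
  nat a i := if a = 0 ∧ i = 0 then n else if a = 0 ∧ i = 1 then k else 0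
  real a i :=
    if h : i < n then
      if a = 0 then p ⟨i, h⟩ 0
      else if a = 1 then p ⟨i, h⟩ 1
      else if a = 2 then r ⟨i, h⟩
      else if a = 3 then w ⟨i, h⟩
      else 0
    else 0

/-- The answer in the final memory: `none` if cell `0` of integer array `1` is `0`, and otherwise the
set of those `i` for which cell `i` of integer array `2` is not `0`. -/
def output (n : ℕ) (s : State) : Option (Finset (Fin n)) :=
  if s.nat 1 0 = 0 then none else some (Finset.univ.filter fun i => s.nat 2 i ≠ 0)

end RealRAM

/-!
The dominating sets of the disk graph are found by dynamic programming over arcs of the convex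
polygon, in `O(k² n³)` steps.

*Structure.*  Let `S` be an inclusion-minimal dominating set, and assign every point `v` to the
disk `u` of `S` that minimizes `dist (p v) (p u) - r u`, ties being broken by the index.  By
minimality no disk of `S` contains another one, so every center is assigned to itself.  If the
chord from `v` to its center met the chord from `v'` to a different center in a point `x`, then one
of the two disks would be the nearer one for `x`, and by the triangle inequality it would be nearer
also for both `v` and `v'` (`diskDist_lt_of_mem_segment`).  Hence the chords of different centers do
not cross, and, the points being in convex position, this is a statement about the cyclic order of
the points alone (`ConvexBelow.chords_meet`, `exists_sol_subset`).

*Recursion.*  Number the positions along the polygon, starting anywhere.  An arc all of whose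
points are assigned to centers in the arc is split at the center `u` of its first point: since
chords do not cross, the points up to `u` and the points from `u` on are assigned to centers in
their own part.  Each of the two parts is split at the point assigned to `u` that is farthest from
`u`; what lies beyond this point is again an arc that is served by its own centers.  So there are
three kinds of partial solutions (`Kind`), each given by the two ends of an arc and a budget, and
each is put together from two smaller ones in at most `n (k + 1)` ways (`Sol`).  Every set that the
recursion produces is a dominating set (`Sol.served`), and every set of centers of a noncrossing
assignment is produced (`IsNoncrossing.sol`).

*Program.*  The position of a point is the number of points that precede it in the order of angles
around the first point (`polygonRank`), so that sorting needs only comparisons of signed areas.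
There are `3 (n + 1)² (k + 1)` cells, numbered such that the parts of a solution have smaller numbers
than the whole (`cellNo`).  One loop over the cell numbers searches the candidates for each cell,
and afterwards writes the set of the best one as `n` bits.  The correctness of the cells is
`CellOK`; the invariant of the search is `SearchInv`.
-/

/-! ### Partial solutions on arcs -/

/-- The three kinds of partial solutions on an arc `[i, j)` of positions along the convex polygon.
* `fwd`: the first position `i` is a center, and belongs to the solution;
* `bwd`: the last position `j - 1` is a center that may be used but belongs to the rest of the
  solution;
* `full`: the arc is served only by centers of the solution. -/
inductive Kind where
  | fwd
  | bwd
  | full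

namespace Kind

/-- The number by which the program represents a kind.  The kinds that may be used for a `full`
solution on the same arc come first. -/
def code : Kind → ℕ
  | fwd => 0
  | bwd => 1
  | full => 2

/-- The kind of the first part of a solution that is split into two. -/
def fst : Kind → Kind
  | fwd => fwd
  | bwd => full
  | full => bwd

/-- The kind of the second part of a solution that is split into two. -/
def snd : Kind → Kind
  | fwd => full
  | bwd => bwd
  | full => fwd

/-- The first part of a solution split at `l` lives on the arc `[i, l + shift)`. -/
def shift : Kind → ℕ
  | full => 1
  | _ => 0

/-- The center that serves the position `l` at which a solution on `[i, j)` is split. -/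
def hub (i l j : ℕ) : Kind → ℕ
  | fwd => i
  | bwd => j - 1
  | full => l

/-- The solution on the empty arc at `i`. -/
def seed (i : ℕ) : Kind → Finset ℕ
  | fwd => {i}
  | _ => ∅

theorem code_lt (κ : Kind) : κ.code < 3 := by cases κ <;> decide

theorem code_injective {κ κ' : Kind} (h : κ.code = κ'.code) : κ = κ' := by
  cases κ <;> cases κ' <;> simp_all [code]

end Kind

/-- `Sol D n κ i j m S`: the set `S` of at most `m` positions is obtained by the recursion as a
partial solution of kind `κ` on the arc `[i, j)` of the `n` positions, where `D u v` says that the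
center `u` serves the position `v`.  The budget `m` is an upper bound, and what is left of it is
absorbed on empty arcs. -/
inductive Sol (D : ℕ → ℕ → Prop) (n : ℕ) : Kind → ℕ → ℕ → ℕ → Finset ℕ → Prop where
  | base (κ : Kind) (i m : ℕ) (h : κ = .fwd → 1 ≤ m ∧ i < n) : Sol D n κ i i m (κ.seed i)
  | join {κ : Kind} {i l j m₁ m₂ : ℕ} {S T : Finset ℕ} (hil : i ≤ l) (hlj : l < j)
      (hub : D (κ.hub i l j) l) (hS : Sol D n κ.fst i (l + κ.shift) m₁ S)
      (hT : Sol D n κ.snd (l + (1 - κ.shift)) j m₂ T) : Sol D n κ i j (m₁ + m₂) (S ∪ T)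

namespace Sol

variable {D : ℕ → ℕ → Prop} {n : ℕ}

theorem le {κ : Kind} {i j m : ℕ} {S : Finset ℕ} (h : Sol D n κ i j m S) : i ≤ j := by
  cases h with
  | base => exact le_rfl
  | join hil hlj => omega

/-- The centers of a partial solution lie on its arc; a `bwd` solution does not contain the
last position of its arc, and a `fwd` solution on the empty arc at `i` is `{i}`. -/
theorem bounds {κ : Kind} {i j m : ℕ} {S : Finset ℕ} (h : Sol D n κ i j m S) :
    ∀ x ∈ S, i ≤ x ∧ match κ with
      | .fwd => x < max j (i + 1)
      | .bwd => x + 1 < j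
      | .full => x < j := by
  induction h with
  | base κ i m h => cases κ <;> simp [Kind.seed]
  | @join κ i l j m₁ m₂ S T hil hlj _ hS hT ihS ihT =>
    intro x hx
    have hle := hT.le
    rcases Finset.mem_union.1 hx with hx | hx
    · have := ihS x hx
      cases κ <;> simp only [Kind.fst, Kind.shift] at this ⊢ <;> omega
    · have := ihT x hx
      cases κ <;> simp only [Kind.snd, Kind.shift] at this ⊢ <;> omega

/-- The two parts of a split solution have no center in common. -/
theorem disjoint {κ : Kind} {i l j m₁ m₂ : ℕ} {S T : Finset ℕ}
    (hS : Sol D n κ.fst i (l + κ.shift) m₁ S) (hT : Sol D n κ.snd (l + (1 - κ.shift)) j m₂ T) :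
    Disjoint S T := by
  rw [Finset.disjoint_left]
  intro x hx hx'
  have h₁ := hS.bounds x hx
  have h₂ := hT.bounds x hx'
  have h₃ := hS.le
  cases κ <;> simp only [Kind.fst, Kind.snd, Kind.shift] at h₁ h₂ h₃ <;> omega

theorem card_le {κ : Kind} {i j m : ℕ} {S : Finset ℕ} (h : Sol D n κ i j m S) : S.card ≤ m := by
  induction h with
  | base κ i m h => cases κ <;> simp [Kind.seed] at h ⊢; omega
  | join _ _ _ _ _ ihS ihT => exact (Finset.card_union_le _ _).trans (by omega)

theorem mono {κ : Kind} {i j m : ℕ} {S : Finset ℕ} (h : Sol D n κ i j m S) :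
    ∀ {m' : ℕ}, m ≤ m' → Sol D n κ i j m' S := by
  induction h with
  | base κ i m h =>
    intro m' hm
    exact .base κ i m' fun hκ => ⟨(h hκ).1.trans hm, (h hκ).2⟩
  | @join κ i l j m₁ m₂ S T hil hlj hub hS hT ihS ihT =>
    intro m' hm
    have := Sol.join hil hlj hub hS (ihT (m' := m' - m₁) (by omega))
    rwa [show m₁ + (m' - m₁) = m' by omega] at this

/-- A partial solution serves all positions of its arc. -/
theorem served {κ : Kind} {i j m : ℕ} {S : Finset ℕ} (h : Sol D n κ i j m S) :
    match κ with
      | .fwd => i ∈ S ∧ ∀ v, i ≤ v → v < j → ∃ u ∈ S, D u v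
      | .bwd => ∀ v, i ≤ v → v < j → D (j - 1) v ∨ ∃ u ∈ S, D u v
      | .full => ∀ v, i ≤ v → v < j → ∃ u ∈ S, D u v := by
  induction h with
  | base κ i m h =>
    cases κ with
    | fwd => exact ⟨by simp [Kind.seed], fun v h₁ h₂ => by omega⟩
    | bwd => exact fun v h₁ h₂ => by omega
    | full => exact fun v h₁ h₂ => by omega
  | @join κ i l j m₁ m₂ S T hil hlj hub hS hT ihS ihT =>
    have left : ∀ v, (∃ u ∈ S, D u v) → ∃ u ∈ S ∪ T, D u v := fun v ⟨u, hu, h⟩ =>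
      ⟨u, Finset.mem_union_left _ hu, h⟩
    have right : ∀ v, (∃ u ∈ T, D u v) → ∃ u ∈ S ∪ T, D u v := fun v ⟨u, hu, h⟩ =>
      ⟨u, Finset.mem_union_right _ hu, h⟩
    cases κ with
    | fwd =>
      simp only [Kind.fst, Kind.snd, Kind.shift, Kind.hub] at ihS ihT hub ⊢
      refine ⟨Finset.mem_union_left _ ihS.1, fun v h₁ h₂ => ?_⟩
      rcases lt_trichotomy v l with hv | rfl | hv
      · exact left v (ihS.2 v h₁ hv)
      · exact left v ⟨i, ihS.1, hub⟩
      · exact right v (ihT v hv h₂)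
    | bwd =>
      simp only [Kind.fst, Kind.snd, Kind.shift, Kind.hub] at ihS ihT hub ⊢
      intro v h₁ h₂
      rcases lt_trichotomy v l with hv | rfl | hv
      · exact .inr (left v (ihS v h₁ hv))
      · exact .inl hub
      · exact (ihT v hv h₂).imp_right (right v)
    | full =>
      simp only [Kind.fst, Kind.snd, Kind.shift] at ihS ihT ⊢
      intro v h₁ h₂
      rcases lt_or_ge v l with hv | hv
      · rcases ihS v h₁ (by omega) with h | h
        · exact right v ⟨l, ihT.1, by simpa using h⟩
        · exact left v h
      · exact right v (ihT.2 v hv h₂)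

end Sol

/-! ### Noncrossing assignments are found by the recursion -/

section Assignment

variable {D : ℕ → ℕ → Prop} {n : ℕ} {f : ℕ → ℕ}

/-- One of the positions `a`, `b` is assigned to the other. -/
def Linked (f : ℕ → ℕ) (a b : ℕ) : Prop := f a = b ∨ f b = a

/-- An assignment `f` of the positions `0, …, n - 1` to centers that assigns each center to itself,
and for which the chords that join positions to their centers do not cross. -/
structure IsNoncrossing (n : ℕ) (f : ℕ → ℕ) : Prop where
  lt : ∀ v < n, f v < n
  idem : ∀ v < n, f (f v) = f v
  not_cross : ∀ a b c d, a < b → b < c → c < d → d < n → Linked f a c → ¬ Linked f b d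

/-- The arc `[i, j)` is closed under `f`. -/
def ArcClosed (f : ℕ → ℕ) (i j : ℕ) : Prop := ∀ v, i ≤ v → v < j → i ≤ f v ∧ f v < j

/-- A `full` solution is found on all short arcs. -/
def FullBelow (D : ℕ → ℕ → Prop) (n : ℕ) (f : ℕ → ℕ) (N : ℕ) : Prop :=
  ∀ i j, i ≤ j → j - i < N → j ≤ n → ArcClosed f i j →
    Sol D n .full i j ((Finset.Ico i j).image f).card ((Finset.Ico i j).image f)

/-- With no budget left over, the budgets of the two parts add up because the parts are disjoint. -/
theorem Sol.join_card {κ : Kind} {i l j : ℕ} {S T U : Finset ℕ} (hil : i ≤ l) (hlj : l < j)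
    (hub : D (κ.hub i l j) l) (hS : Sol D n κ.fst i (l + κ.shift) S.card S)
    (hT : Sol D n κ.snd (l + (1 - κ.shift)) j T.card T) (hU : U = S ∪ T) :
    Sol D n κ i j U.card U := by
  have := Sol.join hil hlj hub hS hT
  rwa [← Finset.card_union_of_disjoint (hS.disjoint hT), ← hU] at this

/-- An arc that begins at a center `u` can be cut at the last position assigned to `u`, since chords
that bridge the cut would cross the chord from this position to `u`. -/
theorem IsNoncrossing.fwd (hf : IsNoncrossing n f) (hD : ∀ v < n, D (f v) v) {N : ℕ}
    (hN : FullBelow D n f N) {u : ℕ} (hu : u < n) (hfu : f u = u) :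
    ∀ j, u ≤ j → j - u ≤ N → j ≤ n → ArcClosed f u j →
      Sol D n .fwd u j (insert u ((Finset.Ico u j).image f)).card
        (insert u ((Finset.Ico u j).image f)) := by
  intro j
  induction j using Nat.strong_induction_on with
  | _ j ih =>
  intro huj hjN hjn hcl
  rcases huj.eq_or_lt with rfl | huj
  · simpa [Kind.seed] using Sol.base .fwd u 1 (D := D) (n := n) fun _ => ⟨le_rfl, hu⟩
  -- split at the last position `l` that is assigned to `u`
  obtain ⟨l, hl, hmax⟩ := ((Finset.Ico u j).filter fun v => f v = u).exists_max_image id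
    ⟨u, by simp [huj, hfu]⟩
  simp only [Finset.mem_filter, Finset.mem_Ico, id] at hl hmax
  obtain ⟨⟨hul, hlj⟩, hfl⟩ := hl
  have h₁ : ArcClosed f u l := by
    intro v hv₁ hv₂
    refine ⟨(hcl v hv₁ (by omega)).1, ?_⟩
    by_contra! hv₃
    have h₁ : u ≠ v := by rintro rfl; omega
    have h₂ : f v ≠ l := by
      intro h
      have := hf.idem v (by omega)
      rw [h] at this; omega
    exact hf.not_cross u v l (f v) (by omega) hv₂ (by omega) (hf.lt v (by omega)) (.inr hfl)
      (.inl rfl)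
  have h₂ : ArcClosed f (l + 1) j := by
    intro v hv₁ hv₂
    refine ⟨?_, (hcl v (by omega) hv₂).2⟩
    by_contra! hv₃
    have h₁ : f v ≠ u := fun h => by have := hmax v ⟨⟨by omega, hv₂⟩, h⟩; omega
    have h₂ : f v ≠ l := by
      intro h
      have := hf.idem v (by omega)
      rw [h] at this; omega
    have := (hcl v (by omega) hv₂).1
    exact hf.not_cross u (f v) l v (by omega) (by omega) (by omega) (by omega) (.inr hfl) (.inr rfl)
  have hfull := hN (l + 1) j (by omega) (by omega) hjn h₂
  refine Sol.join_card (κ := .fwd) hul hlj ?_ (ih l hlj hul (by omega) (by omega) h₁) hfull ?_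
  · simpa [Kind.hub, hfl] using hD l (by omega)
  · rw [← Finset.Ico_union_Ico_eq_Ico hul hlj.le, ← Finset.insert_Ico_add_one_left_eq_Ico hlj,
      Finset.image_union, Finset.image_insert, hfl]
    ext x; simp

/-- The mirror image of `IsNoncrossing.fwd`, except that `u` itself is left out of the solution so
that it is counted only once when the two sides are put together. -/
theorem IsNoncrossing.bwd (hf : IsNoncrossing n f) (hD : ∀ v < n, D (f v) v) {N : ℕ}
    (hN : FullBelow D n f N) {u : ℕ} (hu : u < n) (hfu : f u = u) :
    ∀ d i, u + 1 - i = d → i ≤ u + 1 → u - i < N → ArcClosed f i (u + 1) →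
      Sol D n .bwd i (u + 1) (((Finset.Ico i (u + 1)).image f).erase u).card
        (((Finset.Ico i (u + 1)).image f).erase u) := by
  intro d
  induction d using Nat.strong_induction_on with
  | _ d ih =>
  intro i hd hiu hiN hcl
  rcases hiu.eq_or_lt with rfl | hiu
  · simpa [Kind.seed] using Sol.base .bwd (u + 1) 0 (D := D) (n := n) (by simp)
  -- split at the first position `l` that is assigned to `u`
  obtain ⟨l, hl, hmin⟩ := ((Finset.Ico i (u + 1)).filter fun v => f v = u).exists_min_image id
    ⟨u, by simp [hfu]; omega⟩
  simp only [Finset.mem_filter, Finset.mem_Ico, id] at hl hmin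
  obtain ⟨⟨hil, hlu⟩, hfl⟩ := hl
  have h₁ : ArcClosed f i l := by
    intro v hv₁ hv₂
    have hc := hcl v hv₁ (by omega)
    refine ⟨hc.1, ?_⟩
    by_contra! hv₃
    have h₁ : f v ≠ u := fun h => by have := hmin v ⟨⟨by omega, by omega⟩, h⟩; omega
    have h₂ : f v ≠ l := by
      intro h
      have := hf.idem v (by omega)
      rw [h] at this; omega
    exact hf.not_cross v l (f v) u hv₂ (by omega) (by omega) hu (.inl rfl) (.inl hfl)
  have h₂ : ArcClosed f (l + 1) (u + 1) := by
    intro v hv₁ hv₂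
    have hc := hcl v (by omega) hv₂
    refine ⟨?_, hc.2⟩
    by_contra! hv₃
    have h₁ : v ≠ u := by rintro rfl; omega
    have h₂ : f v ≠ l := by
      intro h
      have := hf.idem v (by omega)
      rw [h] at this; omega
    exact hf.not_cross (f v) l v u (by omega) (by omega) (by omega) hu (.inr rfl) (.inl hfl)
  have hfull := hN i l hil (by omega) (by omega) h₁
  refine Sol.join_card (κ := .bwd) hil hlu ?_ hfull
    (ih (u + 1 - (l + 1)) (by omega) (l + 1) rfl (by omega) (by omega) h₂) ?_
  · simpa [Kind.hub, hfl] using hD l (by omega)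
  · rw [← Finset.Ico_union_Ico_eq_Ico hil hlu.le, ← Finset.insert_Ico_add_one_left_eq_Ico hlu,
      Finset.image_union, Finset.image_insert, hfl]
    have : u ∉ (Finset.Ico i l).image f := by
      simp only [Finset.mem_image, Finset.mem_Ico, not_exists, not_and]
      intro v hv h
      have := hmin v ⟨⟨by omega, by omega⟩, h⟩; omega
    ext x
    by_cases hx : x = u
    · subst hx; simpa using this
    · simp [hx]

/-- Induction on the length of arcs; the solutions on the two sides of the center of the first
position need `full` solutions on shorter arcs only. -/
theorem IsNoncrossing.fullBelow (hf : IsNoncrossing n f) (hD : ∀ v < n, D (f v) v)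
    (hrefl : ∀ v, D v v) (N : ℕ) : FullBelow D n f N := by
  induction N with
  | zero => intro i j _ h; omega
  | succ N hN =>
    intro i j hij hjN hjn hcl
    rcases hij.eq_or_lt with rfl | hij
    · simpa [Kind.seed] using Sol.base .full i 0 (D := D) (n := n) (by simp)
    -- the arc is split at the center of its first position
    obtain ⟨u, hu⟩ : ∃ u, u = f i := ⟨_, rfl⟩
    have hiu : i ≤ u ∧ u < j := hu ▸ hcl i le_rfl hij
    have hfu : f u = u := by rw [hu]; exact hf.idem i (by omega)
    have h₁ : ArcClosed f i (u + 1) := by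
      intro v hv₁ hv₂
      refine ⟨(hcl v hv₁ (by omega)).1, ?_⟩
      by_contra! hv₃
      have h₁ : v ≠ i := by rintro rfl; omega
      have h₂ : v ≠ u := by rintro rfl; omega
      exact hf.not_cross i v u (f v) (by omega) (by omega) (by omega) (hf.lt v (by omega))
        (.inl hu.symm) (.inl rfl)
    have h₂ : ArcClosed f u j := by
      intro v hv₁ hv₂
      refine ⟨?_, (hcl v (by omega) hv₂).2⟩
      by_contra! hv₃
      have hc := (hcl v (by omega) hv₂).1
      have h₂ : v ≠ u := by rintro rfl; omega
      have h₁ : f v ≠ i := by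
        intro h
        have := hf.idem v (by omega)
        rw [h] at this; omega
      exact hf.not_cross i (f v) u v (by omega) (by omega) (by omega) (by omega)
        (.inl hu.symm) (.inr rfl)
    refine Sol.join_card (κ := .full) hiu.1 hiu.2 (hrefl _)
      (hf.bwd hD hN (by omega) hfu _ i rfl (by omega) (by omega) h₁)
      (hf.fwd hD hN (by omega) hfu j (by omega) (by omega) hjn h₂) ?_
    rw [← Finset.Ico_union_Ico_eq_Ico hiu.1 hiu.2.le, Finset.image_union,
      ← Finset.insert_Ico_right_eq_Ico_add_one hiu.1, Finset.image_insert, hfu,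
      ← Finset.insert_Ico_add_one_left_eq_Ico hiu.2, Finset.image_insert, hfu]
    ext x
    by_cases hx : x = u <;> simp [hx]

/-- The recursion finds the set of centers of every noncrossing assignment. -/
theorem IsNoncrossing.sol (hf : IsNoncrossing n f) (hD : ∀ v < n, D (f v) v)
    (hrefl : ∀ v, D v v) :
    Sol D n .full 0 n ((Finset.range n).image f).card ((Finset.range n).image f) := by
  rw [Finset.range_eq_Ico]
  exact hf.fullBelow hD hrefl (n + 1) 0 n (Nat.zero_le _) (by omega) le_rfl
    fun v _ hv => ⟨Nat.zero_le _, hf.lt v hv⟩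

end Assignment

/-! ### Points in convex position -/

section Geometry

/-- The Euclidean plane. -/
abbrev Plane := EuclideanSpace ℝ (Fin 2)

/-- Twice the signed area of the triangle `a b c`. -/
def orient (a b c : Plane) : ℝ :=
  (b 0 - a 0) * (c 1 - a 1) - (b 1 - a 1) * (c 0 - a 0)

theorem Plane.ext_coord {a b : Plane} (h₀ : a 0 = b 0) (h₁ : a 1 = b 1) : a = b := by
  ext i; fin_cases i <;> assumption

/-- No point in convex position is a convex combination of three others. -/
theorem ConvexIndependent.ne_combination {ι : Type*} {p : ι → Plane} (hp : ConvexIndependent ℝ p)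
    {x a b c : ι} (ha : x ≠ a) (hb : x ≠ b) (hc : x ≠ c) {α β γ : ℝ} (h₁ : 0 ≤ α) (h₂ : 0 ≤ β)
    (h₃ : 0 ≤ γ) (hs : α + β + γ = 1) : p x ≠ α • p a + β • p b + γ • p c := by
  intro h
  have hmem : p x ∈ convexHull ℝ (p '' {a, b, c}) := by
    rw [h]
    have hsub := subset_convexHull ℝ (p '' {a, b, c})
    have hcv := convex_convexHull ℝ (p '' {a, b, c})
    have := hcv.sum_mem (t := Finset.univ) (w := ![α, β, γ]) (z := ![p a, p b, p c])
      (by intro i _; fin_cases i <;> simpa) (by simp [Fin.sum_univ_three, hs])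
      (by intro i _; fin_cases i <;> apply hsub <;> simp)
    simpa [Fin.sum_univ_three] using this
  have := hp _ _ hmem
  simp [ha, hb, hc] at this

variable {ι : Type*} {p : ι → Plane}

/-- No three points in convex position are collinear. -/
theorem ConvexIndependent.orient_ne_zero (hp : ConvexIndependent ℝ p) {a b c : ι}
    (hab : a ≠ b) (hac : a ≠ c) (hbc : b ≠ c) : orient (p a) (p b) (p c) ≠ 0 := by
  intro h
  unfold orient at h
  have hN : 0 < (p c 0 - p a 0) ^ 2 + (p c 1 - p a 1) ^ 2 := by
    by_contra! hN
    have h₀ : p c 0 = p a 0 := by nlinarith [sq_nonneg (p c 0 - p a 0), sq_nonneg (p c 1 - p a 1)]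
    have h₁ : p c 1 = p a 1 := by nlinarith [sq_nonneg (p c 0 - p a 0), sq_nonneg (p c 1 - p a 1)]
    exact hac (hp.injective (Plane.ext_coord h₀ h₁)).symm
  obtain ⟨t, ht⟩ : ∃ t, t = ((p b 0 - p a 0) * (p c 0 - p a 0) +
      (p b 1 - p a 1) * (p c 1 - p a 1)) / ((p c 0 - p a 0) ^ 2 + (p c 1 - p a 1) ^ 2) := ⟨_, rfl⟩
  rw [eq_div_iff hN.ne'] at ht
  have h₀ : p b 0 - p a 0 = t * (p c 0 - p a 0) := by
    apply mul_right_cancel₀ hN.ne'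
    linear_combination (p c 1 - p a 1) * h - (p c 0 - p a 0) * ht
  have h₁ : p b 1 - p a 1 = t * (p c 1 - p a 1) := by
    apply mul_right_cancel₀ hN.ne'
    linear_combination -(p c 0 - p a 0) * h - (p c 1 - p a 1) * ht
  rcases lt_or_ge t 0 with h0 | h0
  · have h1 : 0 < 1 - t := by linarith
    refine hp.ne_combination hab hac hac (α := 1 / (1 - t)) (β := -t / (1 - t)) (γ := 0)
      (by positivity) (div_nonneg (by linarith) h1.le) le_rfl (by field_simp; ring) ?_
    apply Plane.ext_coord
    · simp; field_simp; linear_combination -h₀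
    · simp; field_simp; linear_combination -h₁
  rcases le_or_gt t 1 with h1 | h1
  · refine hp.ne_combination hab.symm hbc hbc (α := 1 - t) (β := t) (γ := 0)
      (by linarith) h0 le_rfl (by ring) ?_
    apply Plane.ext_coord
    · simp; linear_combination h₀
    · simp; linear_combination h₁
  · have h2 : 0 < t := by linarith
    refine hp.ne_combination hac.symm hbc.symm hbc.symm (α := 1 - 1 / t) (β := 1 / t) (γ := 0)
      (by rw [sub_nonneg, div_le_one h2]; exact h1.le) (by positivity) le_rfl (by ring) ?_
    apply Plane.ext_coord
    · simp; field_simp; linear_combination -h₀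
    · simp; field_simp; linear_combination -h₁

/-- Seen from one of the points, the others lie in an angle of less than `π`. -/
theorem ConvexIndependent.orient_trans (hp : ConvexIndependent ℝ p) {o a b c : ι}
    (hab : 0 < orient (p o) (p a) (p b)) (hbc : 0 < orient (p o) (p b) (p c)) :
    0 < orient (p o) (p a) (p c) := by
  have hoa : o ≠ a := by rintro rfl; simp [orient] at hab
  have hob : o ≠ b := by rintro rfl; simp [orient] at hbc
  have hoc : o ≠ c := by rintro rfl; simp [orient] at hbc
  by_contra! hac
  unfold orient at hab hbc hac
  -- otherwise `o` is a convex combination of `a`, `b` and `c`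
  obtain ⟨x, hx⟩ : ∃ x, x = orient (p o) (p a) (p b) := ⟨_, rfl⟩
  obtain ⟨y, hy⟩ : ∃ y, y = orient (p o) (p b) (p c) := ⟨_, rfl⟩
  obtain ⟨z, hz⟩ : ∃ z, z = -orient (p o) (p a) (p c) := ⟨_, rfl⟩
  unfold orient at hx hy hz
  rw [← hx] at hab
  rw [← hy] at hbc
  have hz0 : 0 ≤ z := by linarith
  have hs : 0 < x + y + z := by linarith
  refine hp.ne_combination hoa hob hoc (α := y / (x + y + z)) (β := z / (x + y + z))
    (γ := x / (x + y + z)) (by positivity) (by positivity) (by positivity)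
    (by field_simp; ring) ?_
  apply Plane.ext_coord
  · simp; field_simp; subst hx hy hz; ring
  · simp; field_simp; subst hx hy hz; ring

/-- In the order of angles around `o`, the points turn counterclockwise: otherwise `b` would lie in
the triangle `o a c`. -/
theorem ConvexIndependent.orient_pos (hp : ConvexIndependent ℝ p) {o a b c : ι}
    (hab : 0 < orient (p o) (p a) (p b)) (hbc : 0 < orient (p o) (p b) (p c)) :
    0 < orient (p a) (p b) (p c) := by
  have hac := hp.orient_trans hab hbc
  have hob : b ≠ o := by rintro rfl; simp [orient] at hbc
  have hba : b ≠ a := by rintro rfl; simp [orient] at hab; linarith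
  have hbc' : b ≠ c := by rintro rfl; simp [orient] at hbc; linarith
  by_contra! h
  obtain ⟨x, hx⟩ : ∃ x, x = orient (p o) (p a) (p b) := ⟨_, rfl⟩
  obtain ⟨y, hy⟩ : ∃ y, y = orient (p o) (p b) (p c) := ⟨_, rfl⟩
  obtain ⟨z, hz⟩ : ∃ z, z = orient (p o) (p a) (p c) := ⟨_, rfl⟩
  rw [← hx] at hab
  rw [← hy] at hbc
  rw [← hz] at hac
  have hxyz : orient (p a) (p b) (p c) = x + y - z := by
    subst hx hy hz; unfold orient; ring
  rw [hxyz] at h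
  unfold orient at hx hy hz
  refine hp.ne_combination hba hbc' hob (α := y / z) (β := x / z) (γ := 1 - (x + y) / z)
    (by positivity) (by positivity) (by rw [sub_nonneg, div_le_one hac]; linarith)
    (by ring) ?_
  apply Plane.ext_coord
  · simp; field_simp; subst hx hy hz; ring
  · simp; field_simp; subst hx hy hz; ring

/-- The diagonals of a convex quadrilateral meet. -/
theorem exists_mem_segment_of_orient_pos {a b c d : Plane} (h₁ : 0 < orient a b c)
    (h₂ : 0 < orient a c d) (h₃ : 0 < orient a b d) (h₄ : 0 < orient b c d) :
    ∃ x, x ∈ segment ℝ a c ∧ x ∈ segment ℝ b d := by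
  have hs : orient a b c + orient a c d = orient a b d + orient b c d := by
    unfold orient; ring
  have hp : 0 < orient a b d + orient b c d := by linarith
  refine ⟨(orient b c d / (orient a b d + orient b c d)) • a +
    (orient a b d / (orient a b d + orient b c d)) • c,
    ⟨_, _, by positivity, by positivity, by field_simp; ring, rfl⟩,
    ⟨orient a c d / (orient a b d + orient b c d), orient a b c / (orient a b d + orient b c d),
      by positivity, by positivity, by field_simp; linarith, ?_⟩⟩
  apply Plane.ext_coord
  · simp; field_simp; unfold orient; ring
  · simp; field_simp; unfold orient; ring

/-! ### The order along the convex polygon -/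

variable {n : ℕ}

/-- `b` precedes `a` in the counterclockwise order that starts at the point with index `0`. -/
def Precedes (P : ℕ → Plane) (b a : ℕ) : Prop :=
  (b = 0 ∧ a ≠ 0) ∨ 0 < orient (P 0) (P b) (P a)

open Classical in
/-- The number of points that precede `a`. -/
noncomputable def polygonRank (P : ℕ → Plane) (n a : ℕ) : ℕ :=
  ((Finset.range n).filter fun b => Precedes P b a).card

open Classical in
/-- The rank as the program counts it: the truncated difference is `0` for the first point, and is
`1` for all others, which the first point precedes. -/
theorem polygonRank_eq (P : ℕ → Plane) {n a : ℕ} (ha : a < n) : polygonRank P n a =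
    (1 - (1 - a)) + ((Finset.range n).filter fun b => 0 < orient (P 0) (P b) (P a)).card := by
  unfold polygonRank
  rcases Nat.eq_zero_or_pos a with rfl | h
  · simp [Precedes, orient]
  · have : ((Finset.range n).filter fun b => Precedes P b a) =
        insert 0 ((Finset.range n).filter fun b => 0 < orient (P 0) (P b) (P a)) := by
      ext b
      rw [Finset.mem_insert, Finset.mem_filter, Finset.mem_filter, Finset.mem_range, Precedes]
      constructor
      · rintro ⟨hb, ⟨rfl, -⟩ | h⟩
        · exact .inl rfl
        · exact .inr ⟨hb, h⟩
      · rintro (rfl | h')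
        · exact ⟨by omega, .inl ⟨rfl, by omega⟩⟩
        · exact ⟨h'.1, .inr h'.2⟩
    rw [this, Finset.card_insert_of_notMem (by simp [orient])]
    omega

variable {P : ℕ → Plane}

/-- The first `n` points are in convex position. -/
def ConvexBelow (P : ℕ → Plane) (n : ℕ) : Prop := ConvexIndependent ℝ fun i : Fin n => P i

theorem orient_self_right (a b : Plane) : orient a b a = 0 := by simp [orient]

namespace ConvexBelow

variable (hP : ConvexBelow P n)
include hP

theorem precedes_trans {a b c : ℕ} (ha : a < n) (hb : b < n) (hc : c < n)
    (hab : Precedes P a b) (hbc : Precedes P b c) : Precedes P a c := by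
  rcases hab with ⟨rfl, h⟩ | hab <;> rcases hbc with ⟨rfl, h'⟩ | hbc
  · omega
  · refine .inl ⟨rfl, ?_⟩
    rintro rfl
    rw [orient_self_right] at hbc; exact hbc.false
  · rw [orient_self_right] at hab; exact hab.false.elim
  · exact .inr (ConvexIndependent.orient_trans hP (o := ⟨0, by omega⟩) (a := ⟨a, ha⟩)
      (b := ⟨b, hb⟩) (c := ⟨c, hc⟩) hab hbc)

theorem precedes_total {a b : ℕ} (ha : a < n) (hb : b < n) (hab : a ≠ b) :
    Precedes P a b ∨ Precedes P b a := by
  by_cases h : a = 0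
  · exact .inl (.inl ⟨h, by omega⟩)
  by_cases h' : b = 0
  · exact .inr (.inl ⟨h', h⟩)
  have := ConvexIndependent.orient_ne_zero hP (a := ⟨0, by omega⟩) (b := ⟨a, ha⟩) (c := ⟨b, hb⟩)
    (by simp; omega) (by simp; omega) (by simpa)
  rcases this.lt_or_gt with h | h
  · refine .inr (.inr ?_)
    unfold orient at h ⊢; simp only at h; linarith
  · exact .inl (.inr h)

omit hP in
theorem _root_.not_precedes_self (a : ℕ) : ¬ Precedes P a a := by
  rintro (⟨h, h'⟩ | h)
  · exact h' h
  · unfold orient at h; linarith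

theorem rank_lt_rank {a b : ℕ} (ha : a < n) (hb : b < n) (hab : Precedes P a b) :
    polygonRank P n a < polygonRank P n b := by
  classical
  apply Finset.card_lt_card
  rw [Finset.ssubset_iff_of_subset]
  · exact ⟨a, by simp [ha, hab], by simp [not_precedes_self]⟩
  · intro c
    simp only [Finset.mem_filter, Finset.mem_range]
    exact fun ⟨hc, h⟩ => ⟨hc, hP.precedes_trans hc ha hb h hab⟩

omit hP in
theorem _root_.polygonRank_lt {a : ℕ} (ha : a < n) : polygonRank P n a < n := by
  classical
  calc _ < (Finset.range n).card := by
        apply Finset.card_lt_card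
        rw [Finset.ssubset_iff_of_subset (Finset.filter_subset _ _)]
        exact ⟨a, by simpa, by simp [not_precedes_self]⟩
    _ = n := by simp

theorem rank_injOn : Set.InjOn (polygonRank P n) {a | a < n} := by
  intro a ha b hb h
  by_contra hab
  rcases hP.precedes_total ha hb hab with h' | h'
  · exact absurd h (hP.rank_lt_rank ha hb h').ne
  · exact absurd h (hP.rank_lt_rank hb ha h').ne'

theorem exists_rank_eq {t : ℕ} (ht : t < n) : ∃ a < n, polygonRank P n a = t := by
  have : Function.Injective fun a : Fin n => (⟨polygonRank P n a, polygonRank_lt a.2⟩ : Fin n) := by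
    intro a b h
    exact Fin.ext (hP.rank_injOn a.2 b.2 (by simpa using h))
  obtain ⟨a, ha⟩ := Finite.surjective_of_injective this ⟨t, ht⟩
  exact ⟨a, a.2, by simpa using ha⟩

theorem precedes_of_rank_lt {a b : ℕ} (ha : a < n) (hb : b < n)
    (h : polygonRank P n a < polygonRank P n b) : Precedes P a b := by
  rcases hP.precedes_total ha hb (by rintro rfl; exact h.false) with h' | h'
  · exact h'
  · exact absurd (hP.rank_lt_rank hb ha h') (by omega)

theorem orient_pos_of_precedes {a b c : ℕ} (ha : a < n) (hb : b < n) (hc : c < n)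
    (hab : Precedes P a b) (hbc : Precedes P b c) : 0 < orient (P a) (P b) (P c) := by
  rcases hbc with ⟨rfl, -⟩ | hbc
  · rcases hab with ⟨rfl, h⟩ | hab
    · omega
    · rw [orient_self_right] at hab; exact hab.false.elim
  rcases hab with ⟨rfl, -⟩ | hab
  · exact hbc
  · exact ConvexIndependent.orient_pos hP (o := ⟨0, by omega⟩) (a := ⟨a, ha⟩)
      (b := ⟨b, hb⟩) (c := ⟨c, hc⟩) hab hbc

/-- If `pos` lists the points in the order of their ranks, then chords of the polygon whose
end points alternate meet. -/
theorem chords_meet {pos : ℕ → ℕ} (hpos : ∀ a < n, pos (polygonRank P n a) = a) {a b c d : ℕ}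
    (hab : a < b) (hbc : b < c) (hcd : c < d) (hd : d < n) :
    ∃ x, x ∈ segment ℝ (P (pos a)) (P (pos c)) ∧ x ∈ segment ℝ (P (pos b)) (P (pos d)) := by
  obtain ⟨a, ha, rfl⟩ := hP.exists_rank_eq (show a < n by omega)
  obtain ⟨b, hb, rfl⟩ := hP.exists_rank_eq (show b < n by omega)
  obtain ⟨c, hc, rfl⟩ := hP.exists_rank_eq (show c < n by omega)
  obtain ⟨d, hd', rfl⟩ := hP.exists_rank_eq hd
  rw [hpos a ha, hpos b hb, hpos c hc, hpos d hd']
  have h₁ := hP.precedes_of_rank_lt ha hb hab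
  have h₂ := hP.precedes_of_rank_lt hb hc hbc
  have h₃ := hP.precedes_of_rank_lt hc hd' hcd
  have h₄ := hP.precedes_of_rank_lt ha hc (hab.trans hbc)
  have h₅ := hP.precedes_of_rank_lt hb hd' (hbc.trans hcd)
  exact exists_mem_segment_of_orient_pos (hP.orient_pos_of_precedes ha hb hc h₁ h₂)
    (hP.orient_pos_of_precedes ha hc hd' h₄ h₃) (hP.orient_pos_of_precedes ha hb hd' h₁ h₅)
    (hP.orient_pos_of_precedes hb hc hd' h₂ h₃)

end ConvexBelow

end Geometry

/-! ### Nearest centers -/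

section Nearest

variable {E : Type*} [NormedAddCommGroup E] [NormedSpace ℝ E] {n : ℕ} {Q : ℕ → E} {R : ℕ → ℝ}

/-- The distance of the point `x` from the disk with index `u` (negative inside the disk), with ties
between disks broken by the index. -/
noncomputable def diskDist (Q : ℕ → E) (R : ℕ → ℝ) (x : E) (u : ℕ) : ℝ ×ₗ ℕ :=
  toLex (dist x (Q u) - R u, u)

omit [NormedSpace ℝ E] in
theorem diskDist_lt_iff {x : E} {u v : ℕ} : diskDist Q R x u < diskDist Q R x v ↔
    dist x (Q u) - R u < dist x (Q v) - R v ∨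
      dist x (Q u) - R u = dist x (Q v) - R v ∧ u < v := by
  simp [diskDist, Prod.Lex.toLex_lt_toLex]

omit [NormedSpace ℝ E] in
theorem diskDist_le {x : E} {u v : ℕ} (h : diskDist Q R x u ≤ diskDist Q R x v) :
    dist x (Q u) - R u ≤ dist x (Q v) - R v := by
  have := (Prod.Lex.toLex_le_toLex.1 h)
  rcases this with h | h
  · exact h.le
  · exact h.1.le

/-- If `x` lies on the segment from `y` to `Q v`, and the disk `u` is nearer to `x` than the
disk `v`, then it is also nearer to `y`. -/
theorem diskDist_lt_of_mem_segment {x y : E} {u v : ℕ} (hx : x ∈ segment ℝ y (Q v))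
    (h : diskDist Q R x u < diskDist Q R x v) : diskDist Q R y u < diskDist Q R y v := by
  have h₁ : dist y x + dist x (Q v) = dist y (Q v) := dist_add_dist_of_mem_segment hx
  have h₂ : dist y (Q u) ≤ dist y x + dist x (Q u) := dist_triangle _ _ _
  rw [diskDist_lt_iff] at h ⊢
  rcases h with h | ⟨h, huv⟩
  · exact .inl (by linarith)
  · rcases (show dist y (Q u) - R u ≤ dist y (Q v) - R v by linarith).lt_or_eq with h' | h'
    · exact .inl h'
    · exact .inr ⟨h', huv⟩

/-- The disk `u` meets the disk `v`, or is the disk `v`. -/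
def Meets (Q : ℕ → E) (R : ℕ → ℝ) (u v : ℕ) : Prop := dist (Q v) (Q u) ≤ R u + R v

/-- Every dominating set contains one that the recursion finds: pass to a minimal dominating subset
and assign every point to the nearest of its disks.  By minimality no disk of the subset is
contained in another, so that each of them is assigned to itself. -/
theorem exists_sol_subset (hrefl : ∀ v, Meets Q R v v)
    (hcross : ∀ a b c d, a < b → b < c → c < d → d < n →
      ∃ x, x ∈ segment ℝ (Q a) (Q c) ∧ x ∈ segment ℝ (Q b) (Q d))
    {S : Finset ℕ} (hSn : ∀ u ∈ S, u < n) (hS : ∀ v < n, ∃ u ∈ S, Meets Q R u v) :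
    ∃ T ⊆ S, Sol (Meets Q R) n .full 0 n T.card T := by
  classical
  induction S using Finset.strongInduction with
  | H S ih =>
  by_cases hmin : ∃ T ⊂ S, ∀ v < n, ∃ u ∈ T, Meets Q R u v
  · obtain ⟨T, hTS, hT⟩ := hmin
    obtain ⟨U, hU, h⟩ := ih T hTS (fun u hu => hSn u (hTS.1 hu)) hT
    exact ⟨U, hU.trans hTS.1, h⟩
  push Not at hmin
  refine ⟨S, subset_rfl, ?_⟩
  have hex : ∀ v, ∃ u, v < n → u ∈ S ∧
      ∀ u' ∈ S, diskDist Q R (Q v) u ≤ diskDist Q R (Q v) u' := by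
    intro v
    by_cases hv : v < n
    · obtain ⟨u, hu, -⟩ := hS v hv
      obtain ⟨u, hu, h⟩ := S.exists_min_image (diskDist Q R (Q v)) ⟨u, hu⟩
      exact ⟨u, fun _ => ⟨hu, h⟩⟩
    · exact ⟨0, fun h => absurd h hv⟩
  choose f hf using hex
  have hD : ∀ v < n, Meets Q R (f v) v := by
    intro v hv
    obtain ⟨u, hu, h⟩ := hS v hv
    have := diskDist_le ((hf v hv).2 u hu)
    unfold Meets at h ⊢
    linarith
  have hself : ∀ u ∈ S, f u = u := by
    intro u hu
    by_contra hne
    obtain ⟨hfu, hle⟩ := hf u (hSn u hu)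
    have hle := diskDist_le (hle u hu)
    rw [dist_self] at hle
    obtain ⟨v, hv, h⟩ := hmin (S.erase u) (Finset.erase_ssubset hu)
    -- the disk `u` is contained in the disk `f u`
    obtain ⟨u', hu', h'⟩ := hS v hv
    by_cases huu : u' = u
    · subst huu
      apply h (f u') (by simp [hne, hfu])
      have := dist_triangle (Q v) (Q u') (Q (f u'))
      unfold Meets at h' ⊢
      linarith
    · exact h u' (by simp [huu, hu']) h'
  have hlt : ∀ a b, a < n → b < n → f a ≠ f b → ∀ x, x ∈ segment ℝ (Q a) (Q (f a)) →
      x ∈ segment ℝ (Q b) (Q (f b)) → False := by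
    intro a b ha hb hne x hxa hxb
    have hne' : diskDist Q R x (f a) ≠ diskDist Q R x (f b) := by
      simp [diskDist, hne]
    rcases hne'.lt_or_gt with h | h
    · exact absurd ((hf b hb).2 _ (hf a ha).1) (diskDist_lt_of_mem_segment hxb h).not_ge
    · exact absurd ((hf a ha).2 _ (hf b hb).1) (diskDist_lt_of_mem_segment hxa h).not_ge
  have hnc : IsNoncrossing n f := by
    refine ⟨fun v hv => hSn _ (hf v hv).1, fun v hv => hself _ (hf v hv).1, ?_⟩
    intro a b c d hab hbc hcd hd hac hbd
    obtain ⟨x, hx₁, hx₂⟩ := hcross a b c d hab hbc hcd hd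
    rcases hac with hac | hac <;> rcases hbd with hbd | hbd
    · exact hlt a b (by omega) (by omega) (by omega) x (hac ▸ hx₁) (hbd ▸ hx₂)
    · exact hlt a d (by omega) (by omega) (by omega) x (hac ▸ hx₁) (hbd ▸ segment_symm ℝ (Q d) _ ▸ hx₂)
    · exact hlt c b (by omega) (by omega) (by omega) x (by rw [hac, segment_symm]; exact hx₁)
        (hbd ▸ hx₂)
    · exact hlt c d (by omega) (by omega) (by omega) x (by rw [hac, segment_symm]; exact hx₁)
        (by rw [hbd, segment_symm]; exact hx₂)
  have himg : (Finset.range n).image f = S := by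
    ext u
    simp only [Finset.mem_image, Finset.mem_range]
    exact ⟨fun ⟨v, hv, h⟩ => h ▸ (hf v hv).1, fun hu => ⟨u, hSn u hu, hself u hu⟩⟩
  have := hnc.sol hD hrefl
  rwa [himg] at this

end Nearest

/-! ### Reasoning about programs -/

namespace RealRAM

/-- Started in memory `s`, the program `c` halts within `T` steps, in a memory that satisfies `Q`. -/
def Runs (W : ℕ) (c : Program) (s : State) (T : ℕ) (Q : State → Prop) : Prop :=
  ∃ t s', Exec W c s t s' ∧ t ≤ T ∧ Q s'

variable {W : ℕ}

namespace Runs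

theorem mono {c : Program} {s : State} {T T' : ℕ} {Q Q' : State → Prop}
    (h : Runs W c s T Q) (hT : T ≤ T') (hQ : ∀ s', Q s' → Q' s') : Runs W c s T' Q' := by
  obtain ⟨t, s', he, ht, hq⟩ := h
  exact ⟨t, s', he, ht.trans hT, hQ s' hq⟩

theorem skip {s : State} {Q : State → Prop} (h : Q s) : Runs W .skip s 1 Q :=
  ⟨_, _, .skip s, le_rfl, h⟩

theorem natStore {a : ℕ} {i e : NExp} {s : State} {Q : State → Prop} (hi : i.eval s < W)
    (he : e.eval s < W) (h : Q (s.setNat a (i.eval s) (e.eval s))) :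
    Runs W (.natStore a i e) s (i.cost + e.cost + 1) Q :=
  ⟨_, _, .natStore a i e s hi he, le_rfl, h⟩

theorem realStore {a : ℕ} {i : NExp} {e : RExp} {s : State} {Q : State → Prop}
    (hi : i.eval s < W) (h : Q (s.setReal a (i.eval s) (e.eval s))) :
    Runs W (.realStore a i e) s (i.cost + e.cost + 1) Q :=
  ⟨_, _, .realStore a i e s hi, le_rfl, h⟩

theorem seq {c d : Program} {s : State} {T T' : ℕ} {Q : State → Prop}
    (h : Runs W c s T fun s' => Runs W d s' T' Q) : Runs W (.seq c d) s (T + T' + 1) Q := by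
  obtain ⟨t, s', he, ht, t', s'', he', ht', hq⟩ := h
  exact ⟨_, _, .seq he he', by omega, hq⟩

theorem branch {b : BExp} {c d : Program} {s : State} {T T' : ℕ} {Q : State → Prop}
    (h : b.Holds s → Runs W c s T Q) (h' : ¬ b.Holds s → Runs W d s T' Q) :
    Runs W (.branch b c d) s (b.cost + max T T' + 1) Q := by
  by_cases hb : b.Holds s
  · obtain ⟨t, s', he, ht, hq⟩ := h hb
    exact ⟨_, _, .branchTrue hb he, by omega, hq⟩
  · obtain ⟨t, s', he, ht, hq⟩ := h' hb
    exact ⟨_, _, .branchFalse hb he, by omega, hq⟩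

end Runs

/-- Registers: a register is an integer array of which only cell `0` is used. -/
def reg (a : ℕ) : NExp := .get a (.const 0)

/-- `for reg v := 0 to hi - 1 do body`. -/
def forLoop (v : ℕ) (hi : NExp) (body : Program) : Program :=
  .seq (.natStore v (.const 0) (.const 0))
    (.loop (.not (.natLe hi (reg v)))
      (.seq body (.natStore v (.const 0) (.add (reg v) (.const 1)))))

@[simp] theorem State.setNat_nat (s : State) (a i x b : ℕ) : (s.setNat a i x).nat b =
    if b = a then Function.update (s.nat a) i x else s.nat b := by
  simp only [State.setNat, Function.update_apply]

@[simp] theorem State.setNat_real (s : State) (a i x : ℕ) : (s.setNat a i x).real = s.real := rfl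

@[simp] theorem State.setReal_real (s : State) (a i : ℕ) (x : ℝ) (b : ℕ) :
    (s.setReal a i x).real b =
      if b = a then Function.update (s.real a) i x else s.real b := by
  simp only [State.setReal, Function.update_apply]

@[simp] theorem State.setReal_nat (s : State) (a i : ℕ) (x : ℝ) :
    (s.setReal a i x).nat = s.nat := rfl

/-- The rule for counting loops with invariant `I`, where `I i` holds before the `i`-th
execution of the body. -/
theorem Runs.forLoop {v : ℕ} {hi : NExp} {body : Program} {s : State} {T N : ℕ}
    (I : ℕ → State → Prop) {Q : State → Prop} (hN : N < W)
    (hhi : ∀ i s, I i s → s.nat v 0 = i → hi.eval s = N)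
    (h0 : I 0 (s.setNat v 0 0))
    (hstep : ∀ i < N, ∀ s, I i s → s.nat v 0 = i →
      Runs W body s T fun s' => s'.nat v 0 = i ∧ I (i + 1) (s'.setNat v 0 (i + 1)))
    (hQ : ∀ s, I N s → Q s) :
    Runs W (forLoop v hi body) s (N * (T + hi.cost + 12) + hi.cost + 9) Q := by
  have key : ∀ k i s, i + k = N → I i s → s.nat v 0 = i →
      Runs W (.loop (.not (.natLe hi (reg v)))
        (.seq body (.natStore v (.const 0) (.add (reg v) (.const 1))))) s
        (k * (T + hi.cost + 12) + (hi.cost + 5)) Q := by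
    intro k
    induction k with
    | zero =>
      intro i s hi' hI hv
      refine ⟨_, _, .loopFalse ?_, ?_, hQ s ?_⟩
      · simp only [BExp.Holds, not_not, hhi i s hI hv, reg, NExp.eval, hv]; omega
      · simp only [BExp.cost, reg, NExp.cost]; omega
      · obtain rfl : i = N := by omega
        exact hI
    | succ k ih =>
      intro i s hi' hI hv
      obtain ⟨t, s', he, ht, hv', hI'⟩ := hstep i (by omega) s hI hv
      obtain ⟨t', s'', he', ht', hq⟩ := ih (i + 1) _ (by omega) hI' (by simp)
      have hs : Exec W (.natStore v (.const 0) (.add (reg v) (.const 1))) s' 6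
          (s'.setNat v 0 (i + 1)) := by
        have := Exec.natStore (W := W) v (.const 0) (.add (reg v) (.const 1)) s'
          (by simp only [NExp.eval]; omega) (by simp only [NExp.eval, reg, hv']; omega)
        simpa only [NExp.eval, reg, hv', NExp.cost] using this
      refine ⟨_, _, .loopTrue ?_ (.seq he hs) he', ?_, hq⟩
      · simp only [BExp.Holds, hhi i s hI hv, reg, NExp.eval, hv]; omega
      · simp only [BExp.cost, reg, NExp.cost]
        have : (k + 1) * (T + hi.cost + 12) = k * (T + hi.cost + 12) + (T + hi.cost + 12) := by ring
        omega
  have := key N 0 (s.setNat v 0 0) (by omega) h0 (by simp)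
  obtain ⟨t, s', he, ht, hq⟩ := this
  refine ⟨_, _, .seq (.natStore v (.const 0) (.const 0) s ?_ ?_) he, ?_, hq⟩
  all_goals simp only [NExp.eval, NExp.cost]; omega

/-- `s'` agrees with `s` outside the integer arrays in `A` and the real arrays in `B`. -/
structure Agree (A B : List ℕ) (s s' : State) : Prop where
  nat : ∀ a, a ∉ A → s'.nat a = s.nat a
  real : ∀ a, a ∉ B → s'.real a = s.real a

namespace Agree

variable {A B : List ℕ} {s s' s'' : State}

theorem refl : Agree A B s s := ⟨fun _ _ => rfl, fun _ _ => rfl⟩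

theorem trans (h : Agree A B s s') (h' : Agree A B s' s'') : Agree A B s s'' :=
  ⟨fun a ha => (h'.nat a ha).trans (h.nat a ha), fun a ha => (h'.real a ha).trans (h.real a ha)⟩

theorem weaken {A' B' : List ℕ} (h : Agree A B s s') (hA : ∀ a ∈ A, a ∈ A') (hB : ∀ b ∈ B, b ∈ B') :
    Agree A' B' s s' :=
  ⟨fun a ha => h.nat a fun h => ha (hA a h), fun a ha => h.real a fun h => ha (hB a h)⟩

theorem setNat (h : Agree A B s s') {a : ℕ} (ha : a ∈ A) (i x : ℕ) :
    Agree A B s (s'.setNat a i x) := by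
  refine ⟨fun b hb => ?_, h.real⟩
  rw [State.setNat_nat, if_neg (by rintro rfl; exact hb ha)]
  exact h.nat b hb

theorem setReal (h : Agree A B s s') {a : ℕ} (ha : a ∈ B) (i : ℕ) (x : ℝ) :
    Agree A B s (s'.setReal a i x) := by
  refine ⟨h.nat, fun b hb => ?_⟩
  rw [State.setReal_real, if_neg (by rintro rfl; exact hb ha)]
  exact h.real b hb

end Agree

end RealRAM

/-! ### The program

Memory besides input and output: integer array `3` lists the points in their order along the
polygon; integer array `4` and real array `4` hold for each cell a flag that tells whether there is
a solution, and its weight; integer array `5` holds for each cell the `n` bits of its solution.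
Registers: `6` number of the current cell, `7` its budget, `9` and `10` the end and the beginning of
its arc, `11` number of the current candidate, `12` and `13` the cells of the best candidate,
`14` a position, `15` and `16` points to be compared, `17` a rank; `8` is auxiliary. -/

namespace RealRAM

/-- The remainder of `a` modulo `b`. -/
def modE (a b : NExp) : NExp := .sub a (.mul (.div a b) b)

/-- The input number `n`. -/
def nE : NExp := .get 0 (.const 0)

/-- The input number `k`. -/
def kE : NExp := .get 0 (.const 1)

/-- The number of the cell that holds the best solution of kind `κ` on `[i, j)` with budget `m`.
The two parts of a solution that is split lie in cells of smaller number. -/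
def cellNo (n k : ℕ) (κ : Kind) (i j m : ℕ) : ℕ :=
  (((n - i) * (n + 1) + j) * 3 + κ.code) * (k + 1) + m

/-- The number of cells. -/
def cells (n k : ℕ) : ℕ := (n + 1) * (n + 1) * 3 * (k + 1)

/-- The expression for `cellNo`. -/
def cellE (κ : Kind) (i j m : NExp) : NExp :=
  .add (.mul (.add (.mul (.add (.mul (.sub nE i) (.add nE (.const 1))) j) (.const 3))
    (.const κ.code)) (.add kE (.const 1))) m

/-- The entry of the real input array `a` for the point at position `u`. -/
def atPos (a : ℕ) (u : NExp) : RExp := .get a (.get 3 u)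

/-- The test whether the disks at positions `u` and `v` meet. -/
def meetsE (u v : NExp) : BExp :=
  .realLe
    (.add
      (.mul (.sub (atPos 0 u) (atPos 0 v)) (.sub (atPos 0 u) (atPos 0 v)))
      (.mul (.sub (atPos 1 u) (atPos 1 v)) (.sub (atPos 1 u) (atPos 1 v))))
    (.mul (.add (atPos 2 u) (atPos 2 v)) (.add (atPos 2 u) (atPos 2 v)))

/-- The split position of the candidate whose number is in register `11`. -/
def splitE : NExp := .add (reg 10) (.div (reg 11) (.add (reg 7) (.const 1)))

/-- The budget of the first part of the candidate whose number is in register `11`. -/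
def budgetE : NExp := modE (reg 11) (.add (reg 7) (.const 1))

/-- The expression for `Kind.hub` at the current cell and candidate. -/
def hubE : Kind → NExp
  | .fwd => reg 10
  | .bwd => .sub (reg 9) (.const 1)
  | .full => splitE

/-- The cell of the first part of the current candidate. -/
def fstE (κ : Kind) : NExp := cellE κ.fst (reg 10) (.add splitE (.const κ.shift)) budgetE

/-- The cell of the second part of the current candidate. -/
def sndE (κ : Kind) : NExp :=
  cellE κ.snd (.add splitE (.const (1 - κ.shift))) (reg 9) (.sub (reg 7) budgetE)

/-- Compare the current candidate with the best one found so far, and keep the better one. -/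
def joinStep (κ : Kind) : Program :=
  .branch
    (.and (meetsE (hubE κ) splitE)
      (.and (.natLe (.const 1) (.get 4 (fstE κ)))
        (.and (.natLe (.const 1) (.get 4 (sndE κ)))
          (.not (.and (.natLe (.const 1) (.get 4 (reg 6)))
            (.realLe (.get 4 (reg 6)) (.add (.get 4 (fstE κ)) (.get 4 (sndE κ)))))))))
    (.seq (.natStore 12 (.const 0) (fstE κ))
      (.seq (.natStore 13 (.const 0) (sndE κ))
        (.seq (.natStore 4 (reg 6) (.const 1))
          (.realStore 4 (reg 6) (.add (.get 4 (reg 12)) (.get 4 (reg 13)))))))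
    .skip

/-- `1` if `e` is not `0`, and `0` otherwise. -/
def signE (e : NExp) : NExp := .sub (.const 1) (.sub (.const 1) e)

/-- The address in integer array `5` of the bit that tells whether the position in register `14`
belongs to the solution of cell `c`. -/
def bitE (c : NExp) : NExp := .add (.mul c nE) (reg 14)

/-- Write the union of the sets of two cells into the current cell. -/
def unionLoop : Program :=
  forLoop 14 nE (.natStore 5 (bitE (reg 6))
    (signE (.add (.get 5 (bitE (reg 12))) (.get 5 (bitE (reg 13))))))

/-- Fill a cell of a nonempty arc. -/
def joinCell (κ : Kind) : Program :=
  .seq (.natStore 4 (reg 6) (.const 0))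
    (.seq (forLoop 11 (.mul (.sub (reg 9) (reg 10)) (.add (reg 7) (.const 1))) (joinStep κ))
      (.branch (.natLe (.const 1) (.get 4 (reg 6))) unionLoop .skip))

/-- An expression that is not `0` iff there is a solution of kind `κ` on the current empty arc. -/
def seedFlagE : Kind → NExp
  | .fwd => signE (.mul (reg 7) (.sub nE (reg 10)))
  | _ => .const 1

/-- The weight of the solution on the current empty arc. -/
def seedWeightE : Kind → RExp
  | .fwd => atPos 3 (reg 10)
  | _ => .const 0

/-- An expression that is not `0` iff the position in register `14` belongs to the solution on the
current empty arc. -/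
def seedBitE : Kind → NExp
  | .fwd => .sub (.const 1) (.add (.sub (reg 10) (reg 14)) (.sub (reg 14) (reg 10)))
  | _ => .const 0

/-- Fill a cell of an empty arc. -/
def seedCell (κ : Kind) : Program :=
  .seq (.natStore 4 (reg 6) (seedFlagE κ))
    (.seq (.realStore 4 (reg 6) (seedWeightE κ))
      (forLoop 14 nE (.natStore 5 (bitE (reg 6)) (seedBitE κ))))

/-- Fill a cell of kind `κ`. -/
def fillCell (κ : Kind) : Program :=
  .branch (.and (.natLe (reg 9) (reg 10)) (.natLe (reg 10) (reg 9))) (seedCell κ) (joinCell κ)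

/-- Decode the number in register `6` of a cell, and fill the cell. -/
def decodeAndFill : Program :=
  .seq (.natStore 7 (.const 0) (modE (reg 6) (.add kE (.const 1))))
    (.seq (.natStore 8 (.const 0) (.div (reg 6) (.add kE (.const 1))))
      (.seq (.natStore 9 (.const 0) (modE (.div (reg 8) (.const 3)) (.add nE (.const 1))))
        (.seq (.natStore 10 (.const 0)
            (.sub nE (.div (.div (reg 8) (.const 3)) (.add nE (.const 1)))))
          (.branch (.natLe (modE (reg 8) (.const 3)) (.const 0)) (fillCell .fwd)
            (.branch (.natLe (modE (reg 8) (.const 3)) (.const 1)) (fillCell .bwd)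
              (fillCell .full))))))

/-- Fill all cells. -/
def fillLoop : Program :=
  forLoop 6 (.mul (.mul (.mul (.add nE (.const 1)) (.add nE (.const 1))) (.const 3))
    (.add kE (.const 1))) decodeAndFill

/-- The test whether the triangle formed by the points with indices `0` and those in registers `16`
and `15` has positive orientation. -/
def orientPosE : BExp :=
  .not (.realLe
    (.mul (.sub (.get 0 (reg 16)) (.get 0 (.const 0)))
      (.sub (.get 1 (reg 15)) (.get 1 (.const 0))))
    (.mul (.sub (.get 1 (reg 16)) (.get 1 (.const 0)))
      (.sub (.get 0 (reg 15)) (.get 0 (.const 0)))))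

/-- Compute in integer array `3` the list of the points in their order along the polygon: the rank
of each point is counted in register `17`. -/
def sortLoop : Program :=
  forLoop 15 nE
    (.seq (.natStore 17 (.const 0) (signE (reg 15)))
      (.seq (forLoop 16 nE
          (.branch orientPosE (.natStore 17 (.const 0) (.add (reg 17) (.const 1))) .skip))
        (.natStore 3 (reg 17) (reg 15))))

/-- The cell of the solution of the whole problem. -/
def lastE : NExp := cellE .full (.const 0) nE kE

/-- Write the output. -/
def outputLoop : Program :=
  .seq (.natStore 1 (.const 0) (signE (.get 4 lastE)))
    (forLoop 14 nE (.natStore 2 (.get 3 (reg 14)) (signE (.get 5 (bitE lastE)))))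

/-- The dynamic program for dominating sets of size at most `k`. -/
def dominatingSetProgram : Program :=
  .seq sortLoop (.seq fillLoop outputLoop)

end RealRAM

/-! ### Values of derived expressions -/

namespace RealRAM

theorem eval_modE (s : State) (a b : NExp) : (modE a b).eval s = a.eval s % b.eval s := by
  simp only [modE, NExp.eval]
  rw [Nat.mod_eq_sub, Nat.mul_comm]

theorem eval_signE_ne_zero (s : State) (e : NExp) : (signE e).eval s ≠ 0 ↔ e.eval s ≠ 0 := by
  simp only [signE, NExp.eval]; omega

theorem eval_signE_le (s : State) (e : NExp) : (signE e).eval s ≤ 1 := by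
  simp only [signE, NExp.eval]; omega

theorem eval_reg (s : State) (a : ℕ) : (reg a).eval s = s.nat a 0 := rfl

/-! ### Cell numbers -/

section CellNo

variable {n k : ℕ}

theorem cellNo_lt {κ : Kind} {i j m : ℕ} (hj : j ≤ n) (hm : m ≤ k) :
    cellNo n k κ i j m < cells n k := by
  have h₁ : (n - i) * (n + 1) + j + 1 ≤ (n + 1) * (n + 1) := by
    have : (n - i) * (n + 1) ≤ n * (n + 1) := Nat.mul_le_mul_right _ (Nat.sub_le _ _)
    linarith
  have h₂ : ((n - i) * (n + 1) + j) * 3 + κ.code + 1 ≤ (n + 1) * (n + 1) * 3 := by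
    have := κ.code_lt
    omega
  have h₃ := Nat.mul_le_mul_right (k + 1) h₂
  rw [Nat.add_mul, one_mul] at h₃
  unfold cellNo cells
  omega

/-- Cell numbers can be decoded. -/
theorem cellNo_div {κ : Kind} {i j m : ℕ} (hm : m ≤ k) :
    cellNo n k κ i j m / (k + 1) = ((n - i) * (n + 1) + j) * 3 + κ.code := by
  unfold cellNo
  rw [Nat.mul_comm, Nat.mul_add_div (by omega), Nat.div_eq_of_lt (by omega), Nat.add_zero]

theorem cellNo_injective {κ κ' : Kind} {i i' j j' m m' : ℕ} (hi : i ≤ n) (hi' : i' ≤ n)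
    (hj : j ≤ n) (hj' : j' ≤ n) (hm : m ≤ k) (hm' : m' ≤ k)
    (h : cellNo n k κ i j m = cellNo n k κ' i' j' m') : κ = κ' ∧ i = i' ∧ j = j' ∧ m = m' := by
  have h₁ := cellNo_div (n := n) (κ := κ) (i := i) (j := j) hm
  rw [h, cellNo_div hm'] at h₁
  have h₂ := κ.code_lt
  have h₃ := κ'.code_lt
  have h₄ : (n - i') * (n + 1) + j' = (n - i) * (n + 1) + j := by omega
  have h₅ : κ'.code = κ.code := by omega
  have h₆ : n - i' = n - i := by
    have h₇ : ((n - i') * (n + 1) + j') / (n + 1) = ((n - i) * (n + 1) + j) / (n + 1) := by rw [h₄]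
    rwa [Nat.mul_comm, Nat.mul_add_div (by omega), Nat.div_eq_of_lt (a := j') (by omega),
      Nat.mul_comm, Nat.mul_add_div (by omega), Nat.div_eq_of_lt (a := j) (by omega)] at h₇
  rw [h₆] at h₄
  refine ⟨(Kind.code_injective h₅).symm, by omega, by omega, ?_⟩
  unfold cellNo at h
  rw [h₆, h₅, show j' = j by omega] at h
  omega

/-- Cells are ordered by decreasing left end, then by increasing right end, then by kind. -/
theorem cellNo_lt_of {κ κ' : Kind} {i i' j j' m m' : ℕ} (hi' : i' ≤ n) (hj' : j' ≤ n) (hm' : m' ≤ k)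
    (h : i < i' ∨ i = i' ∧ (j' < j ∨ j = j' ∧ κ'.code < κ.code)) :
    cellNo n k κ' i' j' m' < cellNo n k κ i j m := by
  have h₁ : ((n - i') * (n + 1) + j') * 3 + κ'.code + 1 ≤
      ((n - i) * (n + 1) + j) * 3 + κ.code := by
    have := κ'.code_lt
    rcases h with h | ⟨rfl, h⟩
    · have : (n - i' + 1) * (n + 1) ≤ (n - i) * (n + 1) := Nat.mul_le_mul_right _ (by omega)
      rw [Nat.add_mul] at this
      omega
    · rcases h with h | ⟨rfl, h⟩ <;> omega
  have h₂ := Nat.mul_le_mul_right (k + 1) h₁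
  rw [Nat.add_mul, one_mul] at h₂
  unfold cellNo
  omega

theorem cellNo_fst_lt {κ : Kind} {i l j m m' : ℕ} (hil : i ≤ l) (hlj : l < j) (hj : j ≤ n)
    (hm' : m' ≤ k) :
    cellNo n k κ.fst i (l + κ.shift) m' < cellNo n k κ i j m := by
  cases κ <;> refine cellNo_lt_of ?_ ?_ hm' ?_ <;>
    (try simp [Kind.fst, Kind.shift, Kind.code]) <;> omega

theorem cellNo_snd_lt {κ : Kind} {i l j m m' : ℕ} (hil : i ≤ l) (hlj : l < j) (hj : j ≤ n)
    (hm' : m' ≤ k) :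
    cellNo n k κ.snd (l + (1 - κ.shift)) j m' < cellNo n k κ i j m := by
  cases κ <;> refine cellNo_lt_of ?_ ?_ hm' ?_ <;>
    (try simp [Kind.snd, Kind.shift, Kind.code]) <;> omega

theorem one_lt_cells : 1 < cells n k := by
  unfold cells
  have : 1 ≤ (n + 1) * (n + 1) := Nat.one_le_iff_ne_zero.2 (by positivity)
  nlinarith

theorem le_cells : n + 1 < cells n k ∧ (n + 1) * (k + 1) ≤ cells n k := by
  unfold cells
  constructor <;> nlinarith [Nat.zero_le (n * n), Nat.zero_le (n * k), Nat.zero_le (n * n * k)]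

end CellNo

/-! ### Correctness of the cells -/

section Invariant

variable {D : ℕ → ℕ → Prop} {wt : ℕ → ℝ} {n k W : ℕ}

/-- The memory `s` holds the numbers `n` and `k` and sorted points for which `D u v` says that the
disks at positions `u` and `v` meet, and `wt u` is the weight of the point at position `u`. -/
structure Env (D : ℕ → ℕ → Prop) (wt : ℕ → ℝ) (n k : ℕ) (s : State) : Prop where
  n_eq : s.nat 0 0 = n
  k_eq : s.nat 0 1 = k
  meets_iff : ∀ u v, D u v ↔
    (s.real 0 (s.nat 3 u) - s.real 0 (s.nat 3 v)) * (s.real 0 (s.nat 3 u) - s.real 0 (s.nat 3 v)) +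
    (s.real 1 (s.nat 3 u) - s.real 1 (s.nat 3 v)) * (s.real 1 (s.nat 3 u) - s.real 1 (s.nat 3 v)) ≤
    (s.real 2 (s.nat 3 u) + s.real 2 (s.nat 3 v)) * (s.real 2 (s.nat 3 u) + s.real 2 (s.nat 3 v))
  wt_eq : ∀ u, s.real 3 (s.nat 3 u) = wt u

theorem Env.of_agree {A B : List ℕ} {s s' : State} (h : Env D wt n k s) (hs : Agree A B s s')
    (hA : 0 ∉ A ∧ 3 ∉ A := by decide) (hB : 0 ∉ B ∧ 1 ∉ B ∧ 2 ∉ B ∧ 3 ∉ B := by decide) :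
    Env D wt n k s' := by
  obtain ⟨h₁, h₂, h₃, h₄⟩ := h
  constructor
  · rwa [hs.nat 0 hA.1]
  · rwa [hs.nat 0 hA.1]
  · rwa [hs.nat 3 hA.2, hs.real 0 hB.1, hs.real 1 hB.2.1, hs.real 2 hB.2.2.1]
  · rwa [hs.nat 3 hA.2, hs.real 3 hB.2.2.2]

theorem Env.holds_meetsE {s : State} (h : Env D wt n k s) (u v : NExp) :
    (meetsE u v).Holds s ↔ D (u.eval s) (v.eval s) := by
  rw [h.meets_iff]; rfl

theorem Env.eval_cellE {s : State} (h : Env D wt n k s) (κ : Kind) (i j m : NExp) :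
    (cellE κ i j m).eval s = cellNo n k κ (i.eval s) (j.eval s) (m.eval s) := by
  simp only [cellE, NExp.eval, nE, kE, h.n_eq, h.k_eq, cellNo]

/-- The cell of kind `κ` for the arc `[i, j)` and the budget `m` holds a solution of minimum weight,
or there is no solution and the flag of the cell is `0`. -/
def CellOK (D : ℕ → ℕ → Prop) (wt : ℕ → ℝ) (n k : ℕ) (s : State) (κ : Kind) (i j m : ℕ) : Prop :=
  (s.nat 4 (cellNo n k κ i j m) = 0 → ∀ S, ¬ Sol D n κ i j m S) ∧
  (s.nat 4 (cellNo n k κ i j m) ≠ 0 → ∃ S, Sol D n κ i j m S ∧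
    s.real 4 (cellNo n k κ i j m) = ∑ u ∈ S, wt u ∧
    (∀ T, Sol D n κ i j m T → s.real 4 (cellNo n k κ i j m) ≤ ∑ u ∈ T, wt u) ∧
    ∀ t < n, (s.nat 5 (cellNo n k κ i j m * n + t) ≠ 0 ↔ t ∈ S))

/-- `s'` agrees with `s` on the cells with numbers less than `c`. -/
structure SameBelow (n c : ℕ) (s s' : State) : Prop where
  flag : ∀ x < c, s'.nat 4 x = s.nat 4 x
  val : ∀ x < c, s'.real 4 x = s.real 4 x
  bit : ∀ x < c * n, s'.nat 5 x = s.nat 5 x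

theorem SameBelow.trans {c : ℕ} {s s' s'' : State} (h : SameBelow n c s s')
    (h' : SameBelow n c s' s'') : SameBelow n c s s'' :=
  ⟨fun x hx => (h'.flag x hx).trans (h.flag x hx), fun x hx => (h'.val x hx).trans (h.val x hx),
    fun x hx => (h'.bit x hx).trans (h.bit x hx)⟩

theorem bit_lt {a c n t : ℕ} (h : a < c) (ht : t < n) : a * n + t < c * n := by
  have := Nat.mul_le_mul_right n (show a + 1 ≤ c from h)
  rw [Nat.add_mul] at this
  omega

theorem CellOK.of_sameBelow {c : ℕ} {s s' : State} {κ : Kind} {i j m : ℕ}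
    (h : CellOK D wt n k s κ i j m) (hs : SameBelow n c s s') (hc : cellNo n k κ i j m < c) :
    CellOK D wt n k s' κ i j m := by
  unfold CellOK
  rw [hs.flag _ hc, hs.val _ hc]
  refine ⟨h.1, fun h' => ?_⟩
  obtain ⟨S, h₁, h₂, h₃, h₄⟩ := h.2 h'
  exact ⟨S, h₁, h₂, h₃, fun t ht => by rw [hs.bit _ (bit_lt hc ht)]; exact h₄ t ht⟩

/-- All cells with numbers less than `c` are correct. -/
def CellsOK (D : ℕ → ℕ → Prop) (wt : ℕ → ℝ) (n k c : ℕ) (s : State) : Prop :=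
  ∀ κ i j m, i ≤ n → j ≤ n → m ≤ k → cellNo n k κ i j m < c → CellOK D wt n k s κ i j m

/-- The result of a search for a minimum of `val` among the numbers `e < E` that are `valid`: `flag`
is `0` if there is none, and otherwise the minimum is `best` and is attained at some `e`
with property `P`. -/
structure IsBest (valid : ℕ → Prop) (val : ℕ → ℝ) (E flag : ℕ) (best : ℝ) (P : ℕ → Prop) :
    Prop where
  none : flag = 0 → ∀ e < E, ¬ valid e
  some : flag ≠ 0 → ∃ e < E, valid e ∧ P e ∧ best = val e
  min : flag ≠ 0 → ∀ e < E, valid e → best ≤ val e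

namespace IsBest

variable {valid : ℕ → Prop} {val : ℕ → ℝ} {E flag : ℕ} {best : ℝ} {P : ℕ → Prop}

theorem keep (h : IsBest valid val E flag best P) (hE : valid E → flag ≠ 0 ∧ best ≤ val E) :
    IsBest valid val (E + 1) flag best P := by
  refine ⟨fun hf e he hv => ?_, fun hf => ?_, fun hf e he hv => ?_⟩
  · rcases (Nat.lt_succ_iff_lt_or_eq.1 he) with he | rfl
    · exact h.none hf e he hv
    · exact (hE hv).1 hf
  · obtain ⟨e, he, h'⟩ := h.some hf
    exact ⟨e, by omega, h'⟩
  · rcases (Nat.lt_succ_iff_lt_or_eq.1 he) with he | rfl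
    · exact h.min hf e he hv
    · exact (hE hv).2

theorem improve (h : IsBest valid val E flag best P) (hv : valid E)
    (hE : ¬ (flag ≠ 0 ∧ best ≤ val E)) {P' : ℕ → Prop} (hP : P' E) :
    IsBest valid val (E + 1) 1 (val E) P' := by
  refine ⟨by simp, fun _ => ⟨E, by omega, hv, hP, rfl⟩, fun _ e he hve => ?_⟩
  rcases (Nat.lt_succ_iff_lt_or_eq.1 he) with he | rfl
  · have hf : flag ≠ 0 := fun hf => h.none hf e he hve
    have := h.min hf e he hve
    have : val E < best := by by_contra! h'; exact hE ⟨hf, h'⟩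
    linarith
  · exact le_rfl

end IsBest

/-! ### Searching the candidates of a cell -/

/-- The registers describe the cell of kind `κ` for the arc `[i, j)` and the budget `m`. -/
structure AtCell (n k : ℕ) (κ : Kind) (i j m : ℕ) (s : State) : Prop where
  i_le : i ≤ n
  j_le : j ≤ n
  m_le : m ≤ k
  cell_eq : s.nat 6 0 = cellNo n k κ i j m
  i_eq : s.nat 10 0 = i
  j_eq : s.nat 9 0 = j
  m_eq : s.nat 7 0 = m

theorem AtCell.of_agree {A B : List ℕ} {s s' : State} {κ : Kind} {i j m : ℕ}
    (h : AtCell n k κ i j m s) (hs : Agree A B s s')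
    (hA : 6 ∉ A ∧ 10 ∉ A ∧ 9 ∉ A ∧ 7 ∉ A := by decide) : AtCell n k κ i j m s' := by
  obtain ⟨h₁, h₂, h₃, h₄, h₅, h₆, h₇⟩ := h
  refine ⟨h₁, h₂, h₃, ?_, ?_, ?_, ?_⟩
  · rwa [hs.nat 6 hA.1]
  · rwa [hs.nat 10 hA.2.1]
  · rwa [hs.nat 9 hA.2.2.1]
  · rwa [hs.nat 7 hA.2.2.2]

/-- The first part of candidate `e`. -/
def fstNo (n k : ℕ) (κ : Kind) (i m e : ℕ) : ℕ :=
  cellNo n k κ.fst i (i + e / (m + 1) + κ.shift) (e % (m + 1))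

/-- The second part of candidate `e`. -/
def sndNo (n k : ℕ) (κ : Kind) (i j m e : ℕ) : ℕ :=
  cellNo n k κ.snd (i + e / (m + 1) + (1 - κ.shift)) j (m - e % (m + 1))

/-- Candidate `e` is a solution that is split at `i + e / (m + 1)`, with budget `e % (m + 1)` for
its first part. -/
def Valid (D : ℕ → ℕ → Prop) (n k : ℕ) (κ : Kind) (i j m : ℕ) (s : State) (e : ℕ) : Prop :=
  D (κ.hub i (i + e / (m + 1)) j) (i + e / (m + 1)) ∧
    s.nat 4 (fstNo n k κ i m e) ≠ 0 ∧ s.nat 4 (sndNo n k κ i j m e) ≠ 0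

section Eval

variable {s : State} {κ : Kind} {i j m e : ℕ} (hc : AtCell n k κ i j m s)
  (he : s.nat 11 0 = e)
include hc he

theorem AtCell.eval_splitE : splitE.eval s = i + e / (m + 1) := by
  simp only [splitE, NExp.eval, eval_reg, hc.i_eq, he, hc.m_eq]

theorem AtCell.eval_budgetE : budgetE.eval s = e % (m + 1) := by
  rw [budgetE, eval_modE]
  simp only [NExp.eval, eval_reg, he, hc.m_eq]

theorem AtCell.eval_hubE : (hubE κ).eval s = κ.hub i (i + e / (m + 1)) j := by
  cases κ
  · exact hc.i_eq
  · simp only [hubE, NExp.eval, eval_reg, hc.j_eq, Kind.hub]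
  · exact hc.eval_splitE he

theorem AtCell.eval_fstE (h : Env D wt n k s) : (fstE κ).eval s = fstNo n k κ i m e := by
  rw [fstE, h.eval_cellE, hc.eval_budgetE he, fstNo, eval_reg, hc.i_eq]
  simp only [NExp.eval, hc.eval_splitE he]

theorem AtCell.eval_sndE (h : Env D wt n k s) : (sndE κ).eval s = sndNo n k κ i j m e := by
  rw [sndE, h.eval_cellE, sndNo, eval_reg, hc.j_eq]
  simp only [NExp.eval, hc.eval_splitE he, hc.eval_budgetE he, eval_reg, hc.m_eq]

end Eval

theorem div_lt_of_lt_mul_succ {i j m e : ℕ} (he : e < (j - i) * (m + 1)) :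
    i + e / (m + 1) < j := by
  have := Nat.div_lt_of_lt_mul (Nat.mul_comm (j - i) (m + 1) ▸ he)
  generalize e / (m + 1) = x at this ⊢
  omega

theorem fstNo_lt {κ : Kind} {i j m e : ℕ} (hj : j ≤ n) (hm : m ≤ k)
    (he : e < (j - i) * (m + 1)) : fstNo n k κ i m e < cellNo n k κ i j m :=
  cellNo_fst_lt (Nat.le_add_right _ _) (div_lt_of_lt_mul_succ he) hj
    (by have := Nat.mod_lt e (show m + 1 > 0 by omega); omega)

theorem sndNo_lt {κ : Kind} {i j m e : ℕ} (hj : j ≤ n) (hm : m ≤ k)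
    (he : e < (j - i) * (m + 1)) : sndNo n k κ i j m e < cellNo n k κ i j m :=
  cellNo_snd_lt (Nat.le_add_right _ _) (div_lt_of_lt_mul_succ he) hj (by omega)

/-- Invariant of the search for the best solution of a cell, with respect to the memory `s₀` at the
start of the search. -/
structure SearchInv (D : ℕ → ℕ → Prop) (n k : ℕ) (κ : Kind) (i j m : ℕ) (s₀ : State) (E : ℕ)
    (s : State) : Prop where
  agree : Agree [4, 11, 12, 13] [4] s₀ s
  same : SameBelow n (cellNo n k κ i j m) s₀ s
  best : IsBest (Valid D n k κ i j m s₀)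
    (fun e => s₀.real 4 (fstNo n k κ i m e) + s₀.real 4 (sndNo n k κ i j m e)) E
    (s.nat 4 (cellNo n k κ i j m)) (s.real 4 (cellNo n k κ i j m))
    (fun e => s.nat 12 0 = fstNo n k κ i m e ∧ s.nat 13 0 = sndNo n k κ i j m e)

theorem SearchInv.setNat {κ : Kind} {i j m E : ℕ} {s₀ s : State}
    (h : SearchInv D n k κ i j m s₀ E s) (x : ℕ) :
    SearchInv D n k κ i j m s₀ E (s.setNat 11 0 x) :=
  ⟨h.agree.setNat (by decide) _ _, ⟨h.same.flag, h.same.val, h.same.bit⟩, h.best⟩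

/-- The time bounds here and below are generous. -/
theorem runs_joinStep {κ : Kind} {i j m e : ℕ} {s₀ s : State} (hW : cells n k ≤ W)
    (henv : Env D wt n k s₀) (hc : AtCell n k κ i j m s₀) (he : e < (j - i) * (m + 1))
    (hI : SearchInv D n k κ i j m s₀ e s) (hes : s.nat 11 0 = e) :
    Runs W (joinStep κ) s 1000 fun s' =>
      s'.nat 11 0 = e ∧ SearchInv D n k κ i j m s₀ (e + 1) s' := by
  have henv' := henv.of_agree hI.agree
  have hc' := hc.of_agree hI.agree
  have hf := fstNo_lt (κ := κ) hc.j_le hc.m_le he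
  have hs := sndNo_lt (κ := κ) hc.j_le hc.m_le he
  have hlt := cellNo_lt (κ := κ) (i := i) hc.j_le hc.m_le
  have h1 := one_lt_cells (n := n) (k := k)
  refine Runs.mono (Runs.branch (T := 500) (T' := 1) (fun hb => ?_) fun hb => ?_) ?_ fun _ h => h
  · simp only [BExp.Holds, henv'.holds_meetsE, hc'.eval_hubE hes, hc'.eval_splitE hes, NExp.eval,
      RExp.eval, hc'.eval_fstE hes henv', hc'.eval_sndE hes henv', eval_reg, hc'.cell_eq,
      hI.same.flag _ hf, hI.same.flag _ hs, hI.same.val _ hf, hI.same.val _ hs,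
      Nat.one_le_iff_ne_zero] at hb
    obtain ⟨hb₁, hb₂, hb₃, hb₄⟩ := hb
    have h12 := hI.agree.setNat (a := 12) (by decide) 0 (fstNo n k κ i m e)
    have heval : (sndE κ).eval (s.setNat 12 0 (fstNo n k κ i m e)) = sndNo n k κ i j m e :=
      (hc.of_agree h12).eval_sndE (by simpa using hes) (henv.of_agree h12)
    refine Runs.mono (Runs.seq <| Runs.natStore ?_ ?_ <| Runs.seq <| Runs.natStore ?_ ?_ <|
      Runs.seq <| Runs.natStore ?_ ?_ <| Runs.realStore ?_ ?_) ?_ fun _ h => h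
    all_goals try simp only [hc'.eval_fstE hes henv', NExp.eval, heval, eval_reg]
    · omega
    · omega
    · omega
    · omega
    · simp [hc'.cell_eq]; omega
    · omega
    · simp [hc'.cell_eq]; omega
    · have hag := (((hI.agree.setNat (a := 12) (by decide) 0 (fstNo n k κ i m e)).setNat (a := 13)
          (by decide) 0 (sndNo n k κ i j m e)).setNat (a := 4) (by decide)
          (cellNo n k κ i j m) 1).setReal (a := 4) (by decide) (cellNo n k κ i j m)
          (s₀.real 4 (fstNo n k κ i m e) + s₀.real 4 (sndNo n k κ i j m e))
      simp [RExp.eval, eval_reg, hc'.cell_eq]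
      rw [hI.same.val _ hf, hI.same.val _ hs]
      refine ⟨hes, hag, ⟨fun x hx => ?_, fun x hx => ?_, fun x hx => ?_⟩, ?_⟩
      · simp [Function.update_of_ne hx.ne, hI.same.flag x hx]
      · simp [Function.update_of_ne hx.ne, hI.same.val x hx]
      · simp [hI.same.bit x hx]
      · have := hI.best.improve (P' := fun e' => fstNo n k κ i m e = fstNo n k κ i m e' ∧
          sndNo n k κ i j m e = sndNo n k κ i j m e') ⟨hb₁, hb₂, hb₃⟩ hb₄ ⟨rfl, rfl⟩
        simpa using this
    · cases κ <;> decide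
  · refine Runs.skip ⟨hes, hI.agree, hI.same, hI.best.keep fun hv => ?_⟩
    by_contra hb'
    apply hb
    simp only [BExp.Holds, henv'.holds_meetsE, hc'.eval_hubE hes, hc'.eval_splitE hes, NExp.eval,
      RExp.eval, hc'.eval_fstE hes henv', hc'.eval_sndE hes henv', eval_reg, hc'.cell_eq,
      hI.same.flag _ hf, hI.same.flag _ hs, hI.same.val _ hf, hI.same.val _ hs,
      Nat.one_le_iff_ne_zero]
    exact ⟨hv.1, hv.2.1, hv.2.2, hb'⟩
  · cases κ <;> decide

end Invariant

end RealRAM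

/-! ### Filling the cells -/

namespace RealRAM

section Fill

variable {D : ℕ → ℕ → Prop} {wt : ℕ → ℝ} {n k W : ℕ}

/-- Write the bits of a set into the current cell. -/
theorem runs_bitLoop {c : ℕ} {E : NExp} {P : ℕ → Prop} {s : State}
    (hW : cells n k * (n + 1) ≤ W) (hn : s.nat 0 0 = n) (hc : s.nat 6 0 = c) (hlt : c < cells n k)
    (hE : ∀ t < n, ∀ s', Agree [5, 14] [] s s' → (∀ x < c * n, s'.nat 5 x = s.nat 5 x) →
      s'.nat 14 0 = t → E.eval s' ≤ 1 ∧ (E.eval s' ≠ 0 ↔ P t)) :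
    Runs W (forLoop 14 nE (.natStore 5 (bitE (reg 6)) E)) s (n * (E.cost + 30) + 20) fun s' =>
      Agree [5, 14] [] s s' ∧ (∀ x < c * n, s'.nat 5 x = s.nat 5 x) ∧
        ∀ t < n, (s'.nat 5 (c * n + t) ≠ 0 ↔ P t) := by
  have hcells := one_lt_cells (n := n) (k := k)
  rw [Nat.mul_add_one] at hW
  have hW' := Nat.zero_le (cells n k * n)
  have hle := le_cells (n := n) (k := k)
  refine Runs.mono (Runs.forLoop (T := (bitE (reg 6)).cost + E.cost + 1) (N := n) (fun t s' => Agree [5, 14] [] s s' ∧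
    (∀ x < c * n, s'.nat 5 x = s.nat 5 x) ∧ ∀ t' < t, (s'.nat 5 (c * n + t') ≠ 0 ↔ P t'))
    (by omega) (fun t s' h _ => by simp [nE, NExp.eval, h.1.nat 0 (by decide), hn])
    ⟨Agree.refl.setNat (by decide) _ _, by simp, by simp⟩ ?_ fun s' h => h) ?_ fun s' h => h
  · rintro t ht s' ⟨h₁, h₂, h₃⟩ ht'
    have hE' := hE t ht s' h₁ h₂ ht'
    have hbit : (bitE (reg 6)).eval s' = c * n + t := by
      simp [bitE, NExp.eval, nE, eval_reg, h₁.nat 0 (by decide), h₁.nat 6 (by decide), hn, hc, ht']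
    have := bit_lt hlt ht
    refine Runs.natStore (by omega) (by omega) ⟨by simpa using ht', ?_, ?_, ?_⟩
    · exact (h₁.setNat (by decide) _ _).setNat (by decide) _ _
    · intro x hx
      simp [hbit, Function.update_of_ne (show x ≠ c * n + t by omega), h₂ x hx]
    · intro t' ht''
      simp only [hbit, State.setNat_nat]
      rcases Nat.lt_succ_iff_lt_or_eq.1 ht'' with h | rfl
      · simp [Function.update_of_ne (show c * n + t' ≠ c * n + t by omega)]
        simpa using h₃ t' h
      · simpa using hE'.2
  · simp only [bitE, nE, reg, NExp.cost]
    ring_nf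
    omega

/-- What filling the cell of kind `κ` for the arc `[i, j)` and the budget `m` achieves. -/
structure Filled (D : ℕ → ℕ → Prop) (wt : ℕ → ℝ) (n k : ℕ) (κ : Kind) (i j m : ℕ)
    (s s' : State) : Prop where
  agree : Agree [4, 5, 11, 12, 13, 14] [4] s s'
  same : SameBelow n (cellNo n k κ i j m) s s'
  ok : CellOK D wt n k s' κ i j m

/-- Every way to split an arc and its budget is the candidate with some number. -/
theorem exists_candidate {i l j m₁ m₂ : ℕ} (hil : i ≤ l) (hlj : l < j) :
    ∃ e < (j - i) * (m₁ + m₂ + 1), i + e / (m₁ + m₂ + 1) = l ∧ e % (m₁ + m₂ + 1) = m₁ := by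
  refine ⟨(m₁ + m₂ + 1) * (l - i) + m₁, ?_, ?_, ?_⟩
  · have := Nat.mul_le_mul_right (m₁ + m₂ + 1) (show l - i + 1 ≤ j - i by omega)
    rw [Nat.add_mul, one_mul] at this
    rw [Nat.mul_comm]
    omega
  · rw [Nat.mul_add_div (by omega), Nat.div_eq_of_lt (by omega)]; omega
  · rw [Nat.mul_add_mod, Nat.mod_eq_of_lt (by omega)]

/-- By the recursion, the best candidate is an optimal solution. -/
theorem SearchInv.cellOK {κ : Kind} {i j m : ℕ} {s₀ s s' : State} (hij : i ≠ j)
    (hi : i ≤ n) (hj : j ≤ n) (hm : m ≤ k) (hok : CellsOK D wt n k (cellNo n k κ i j m) s₀)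
    (h : SearchInv D n k κ i j m s₀ ((j - i) * (m + 1)) s)
    (hflag : s'.nat 4 = s.nat 4) (hval : s'.real 4 = s.real 4)
    (hbit : s.nat 4 (cellNo n k κ i j m) ≠ 0 → ∀ t < n,
      (s'.nat 5 (cellNo n k κ i j m * n + t) ≠ 0 ↔
        s.nat 5 (s.nat 12 0 * n + t) ≠ 0 ∨ s.nat 5 (s.nat 13 0 * n + t) ≠ 0)) :
    CellOK D wt n k s' κ i j m := by
  have hparts : ∀ e < (j - i) * (m + 1),
      CellOK D wt n k s₀ κ.fst i (i + e / (m + 1) + κ.shift) (e % (m + 1)) ∧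
      CellOK D wt n k s₀ κ.snd (i + e / (m + 1) + (1 - κ.shift)) j (m - e % (m + 1)) := by
    intro e he
    have h₁ := div_lt_of_lt_mul_succ he
    have h₂ : e % (m + 1) < m + 1 := Nat.mod_lt e (by omega)
    have h₃ : κ.shift ≤ 1 := by cases κ <;> decide
    generalize hx : e / (m + 1) = x at h₁ ⊢
    refine ⟨hok _ _ _ _ hi (by omega) (by omega) ?_, hok _ _ _ _ (by omega) hj (by omega) ?_⟩
    · exact hx ▸ fstNo_lt hj hm he
    · exact hx ▸ sndNo_lt hj hm he
  have hcand : ∀ T, Sol D n κ i j m T → ∃ e < (j - i) * (m + 1), Valid D n k κ i j m s₀ e ∧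
      s₀.real 4 (fstNo n k κ i m e) + s₀.real 4 (sndNo n k κ i j m e) ≤ ∑ u ∈ T, wt u := by
    intro T hT
    cases hT with
    | base => exact absurd rfl hij
    | @join _ _ l _ m₁ m₂ S T hil hlj hub hS hT =>
      obtain ⟨e, he, hl, hm₁⟩ := exists_candidate (m₁ := m₁) (m₂ := m₂) hil hlj
      obtain ⟨hp₁, hp₂⟩ := hparts e he
      unfold Valid fstNo sndNo
      rw [hl, hm₁] at hp₁ hp₂
      rw [Nat.add_sub_cancel_left] at hp₂
      refine ⟨e, he, ?_⟩
      rw [hl, hm₁, Nat.add_sub_cancel_left]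
      have hf₁ := fun h => hp₁.1 h S hS
      have hf₂ := fun h => hp₂.1 h T hT
      obtain ⟨-, -, -, hmin₁, -⟩ := hp₁.2 hf₁
      obtain ⟨-, -, -, hmin₂, -⟩ := hp₂.2 hf₂
      exact ⟨⟨hub, hf₁, hf₂⟩,
        by rw [Finset.sum_union (hS.disjoint hT)]; exact add_le_add (hmin₁ S hS) (hmin₂ T hT)⟩
  unfold CellOK
  rw [hflag, hval]
  refine ⟨fun h0 T hT => ?_, fun h0 => ?_⟩
  · obtain ⟨e, he, hv, -⟩ := hcand T hT
    exact h.best.none h0 e he hv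
  · obtain ⟨e, he, hv, ⟨h12, h13⟩, hval⟩ := h.best.some h0
    obtain ⟨hp₁, hp₂⟩ := hparts e he
    obtain ⟨S, hS, hwS, -, hbS⟩ := hp₁.2 hv.2.1
    obtain ⟨T, hT, hwT, -, hbT⟩ := hp₂.2 hv.2.2
    have hlt : e % (m + 1) < m + 1 := Nat.mod_lt e (by omega)
    have hsol := Sol.join (Nat.le_add_right _ _) (div_lt_of_lt_mul_succ he) hv.1 hS hT
    rw [show e % (m + 1) + (m - e % (m + 1)) = m by omega] at hsol
    refine ⟨S ∪ T, hsol, ?_, fun U hU => ?_, fun t ht => ?_⟩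
    · rw [hval, Finset.sum_union (hS.disjoint hT), ← hwS, ← hwT]; rfl
    · obtain ⟨e', he', hv', hle⟩ := hcand U hU
      exact (h.best.min h0 e' he' hv').trans hle
    · rw [hbit h0 t ht, h12, h13, h.same.bit _ (bit_lt (fstNo_lt hj hm he) ht),
        h.same.bit _ (bit_lt (sndNo_lt hj hm he) ht), Finset.mem_union]
      exact or_congr (hbS t ht) (hbT t ht)

theorem runs_joinCell {κ : Kind} {i j m : ℕ} {s : State} (hW : cells n k * (n + 1) ≤ W)
    (henv : Env D wt n k s) (hc : AtCell n k κ i j m s)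
    (hok : CellsOK D wt n k (cellNo n k κ i j m) s) (hij : i ≠ j) :
    Runs W (joinCell κ) s (3000 * ((n + 1) * (k + 1))) (Filled D wt n k κ i j m s) := by
  have hcells := one_lt_cells (n := n) (k := k)
  have hle := le_cells (n := n) (k := k)
  have hW₁ : cells n k ≤ W := by
    rw [Nat.mul_add_one] at hW; have := Nat.zero_le (cells n k * n); omega
  have hlt := cellNo_lt (κ := κ) (i := i) hc.j_le hc.m_le
  have hN : (j - i) * (m + 1) ≤ n * (k + 1) :=
    Nat.mul_le_mul (by have := hc.j_le; omega) (by have := hc.m_le; omega)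
  have hN' : n * (k + 1) < (n + 1) * (k + 1) := by rw [Nat.add_mul]; omega
  obtain ⟨s₀, hs₀⟩ : ∃ s₀, s₀ = s.setNat 4 (cellNo n k κ i j m) 0 := ⟨_, rfl⟩
  have ha₀ : Agree [4] [] s s₀ := hs₀ ▸ Agree.refl.setNat (by decide) _ _
  have hsame₀ : SameBelow n (cellNo n k κ i j m) s s₀ := by
    subst hs₀
    exact ⟨fun x hx => by simp [Function.update_of_ne hx.ne], fun x hx => rfl, fun x hx => by simp⟩
  have henv₀ := henv.of_agree ha₀
  have hc₀ := hc.of_agree ha₀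
  have hok₀ : CellsOK D wt n k (cellNo n k κ i j m) s₀ := fun κ' i' j' m' h₁ h₂ h₃ h₄ =>
    (hok κ' i' j' m' h₁ h₂ h₃ h₄).of_sameBelow hsame₀ h₄
  have hsearch : Runs W (forLoop 11 (.mul (.sub (reg 9) (reg 10)) (.add (reg 7) (.const 1)))
      (joinStep κ)) s₀ (1100 * ((n + 1) * (k + 1)))
      (SearchInv D n k κ i j m s₀ ((j - i) * (m + 1))) := by
    refine Runs.mono (Runs.forLoop (T := 1000) (N := (j - i) * (m + 1)) (SearchInv D n k κ i j m s₀) (by omega)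
      (fun e s' h _ => ?_) ?_ (fun e he s' h hes => ?_) fun s' h => h) ?_ fun s' h => h
    · have hc' := hc₀.of_agree h.agree
      simp only [NExp.eval, eval_reg, hc'.i_eq, hc'.j_eq, hc'.m_eq]
    · refine ⟨Agree.refl.setNat (by decide) _ _, ⟨by simp, by simp, by simp⟩, ?_, ?_, ?_⟩
      · intro _ e he; omega
      · intro h; simp [hs₀] at h
      · intro _ e he; omega
    · exact (runs_joinStep hW₁ henv₀ hc₀ he h hes).mono le_rfl fun s' h' => ⟨h'.1, h'.2.setNat _⟩
    · simp only [NExp.cost, reg]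
      omega
  have hrest : ∀ s₁, SearchInv D n k κ i j m s₀ ((j - i) * (m + 1)) s₁ →
      Runs W (.branch (.natLe (.const 1) (.get 4 (reg 6))) unionLoop .skip) s₁ (n * 60 + 30)
        (Filled D wt n k κ i j m s) := by
    intro s₁ h₁
    have hc₁ := hc₀.of_agree h₁.agree
    have henv₁ := henv₀.of_agree h₁.agree
    refine Runs.mono (Runs.branch (T := n * 60 + 20) (T' := 1) (fun hb => ?_) fun hb => ?_) ?_
      fun s' h => h
    · simp only [BExp.Holds, NExp.eval, eval_reg, hc₁.cell_eq, Nat.one_le_iff_ne_zero] at hb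
      obtain ⟨e, he, -, ⟨h12, h13⟩, -⟩ := h₁.best.some hb
      have hf := fstNo_lt (κ := κ) hc.j_le hc.m_le he
      have hs := sndNo_lt (κ := κ) hc.j_le hc.m_le he
      rw [← h12] at hf
      rw [← h13] at hs
      refine (runs_bitLoop hW henv₁.n_eq hc₁.cell_eq hlt (P := fun t =>
        s₁.nat 5 (s₁.nat 12 0 * n + t) ≠ 0 ∨ s₁.nat 5 (s₁.nat 13 0 * n + t) ≠ 0) ?_).mono ?_ ?_
      · intro t ht s' h₁' h₂ h₃
        refine ⟨eval_signE_le _ _, ?_⟩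
        rw [eval_signE_ne_zero]
        simp only [bitE, NExp.eval, eval_reg, nE, h₃, h₁'.nat 12 (by decide),
          h₁'.nat 13 (by decide), h₁'.nat 0 (by decide), henv₁.n_eq, h₂ _ (bit_lt hf ht),
          h₂ _ (bit_lt hs ht)]
        omega
      · simp only [signE, bitE, nE, reg, NExp.cost]; omega
      · rintro s' ⟨h₁', h₂, h₃⟩
        refine ⟨?_, ?_, ?_⟩
        · exact (ha₀.weaken (by simp) (by simp)).trans
            ((h₁.agree.weaken (by simp) (by simp)).trans (h₁'.weaken (by simp) (by simp)))
        · exact hsame₀.trans (h₁.same.trans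
            ⟨by simp [h₁'.nat 4 (by decide)], by simp [h₁'.real 4 (by decide)], h₂⟩)
        · exact h₁.cellOK hij hc.i_le hc.j_le hc.m_le hok₀ (h₁'.nat 4 (by decide))
            (h₁'.real 4 (by decide)) fun _ => h₃
    · simp only [BExp.Holds, NExp.eval, eval_reg, hc₁.cell_eq, Nat.one_le_iff_ne_zero] at hb
      refine Runs.skip ⟨?_, hsame₀.trans h₁.same, ?_⟩
      · exact (ha₀.weaken (by simp) (by simp)).trans (h₁.agree.weaken (by simp) (by simp))
      · exact h₁.cellOK hij hc.i_le hc.j_le hc.m_le hok₀ rfl rfl fun h => absurd h hb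
    · simp only [BExp.cost, NExp.cost, reg]; omega
  have h6 : (reg 6).eval s = cellNo n k κ i j m := hc.cell_eq
  refine Runs.mono (Runs.seq <| Runs.natStore ?_ ?_ <| Runs.seq <|
    Runs.mono (T := 1100 * ((n + 1) * (k + 1)))
      (Q := SearchInv D n k κ i j m s₀ ((j - i) * (m + 1))) ?_ le_rfl hrest) ?_ fun s' h => h
  · omega
  · simp only [NExp.eval]; omega
  · rw [h6]; simpa only [NExp.eval, ← hs₀] using hsearch
  · simp only [NExp.cost, reg]
    have : n < (n + 1) * (k + 1) := by nlinarith
    omega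

theorem runs_seedCell {κ : Kind} {i m : ℕ} {s : State} (hW : cells n k * (n + 1) ≤ W)
    (henv : Env D wt n k s) (hc : AtCell n k κ i i m s) :
    Runs W (seedCell κ) s (200 * (n + 1)) (Filled D wt n k κ i i m s) := by
  have hcells := one_lt_cells (n := n) (k := k)
  have hW₁ : cells n k ≤ W := by
    rw [Nat.mul_add_one] at hW; have := Nat.zero_le (cells n k * n); omega
  have hlt := cellNo_lt (κ := κ) (i := i) hc.j_le hc.m_le
  have h6 : (reg 6).eval s = cellNo n k κ i i m := hc.cell_eq
  have hflag : (seedFlagE κ).eval s ≤ 1 ∧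
      ((seedFlagE κ).eval s ≠ 0 ↔ (κ = .fwd → 1 ≤ m ∧ i < n)) := by
    cases κ with
    | fwd =>
      refine ⟨eval_signE_le _ _, ?_⟩
      rw [seedFlagE, eval_signE_ne_zero]
      simp only [NExp.eval, eval_reg, hc.m_eq, hc.i_eq, nE, henv.n_eq, Nat.mul_ne_zero_iff]
      simp; omega
    | bwd => simp [seedFlagE, NExp.eval]
    | full => simp [seedFlagE, NExp.eval]
  obtain ⟨f, hf⟩ : ∃ f, f = (seedFlagE κ).eval s := ⟨_, rfl⟩
  rw [← hf] at hflag
  obtain ⟨s₁, hs₁⟩ : ∃ s₁, s₁ = (s.setNat 4 (cellNo n k κ i i m) f).setReal 4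
    (cellNo n k κ i i m) (∑ u ∈ κ.seed i, wt u) := ⟨_, rfl⟩
  have ha₁ : Agree [4] [4] s s₁ :=
    hs₁ ▸ (Agree.refl.setNat (by decide) _ _).setReal (by decide) _ _
  have hweight : (seedWeightE κ).eval (s.setNat 4 (cellNo n k κ i i m) f) =
      ∑ u ∈ κ.seed i, wt u := by
    cases κ with
    | fwd => simp [seedWeightE, atPos, RExp.eval, NExp.eval, eval_reg, Kind.seed, hc.i_eq,
        henv.wt_eq]
    | bwd => simp [seedWeightE, RExp.eval, Kind.seed]
    | full => simp [seedWeightE, RExp.eval, Kind.seed]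
  have henv₁ := henv.of_agree ha₁
  have hc₁ := hc.of_agree ha₁
  refine Runs.mono (Runs.seq <| Runs.natStore ?_ ?_ <| Runs.seq (T' := n * 60 + 20) <|
    Runs.realStore ?_ ?_) ?_ fun s' h => h
  · omega
  · omega
  · simp [eval_reg, hc.cell_eq]; omega
  · rw [h6, ← hf, hweight]
    rw [show (reg 6).eval (s.setNat 4 (cellNo n k κ i i m) f) = cellNo n k κ i i m by
      simp [eval_reg, hc.cell_eq], ← hs₁]
    refine (runs_bitLoop hW henv₁.n_eq hc₁.cell_eq hlt (P := fun t => t ∈ κ.seed i) ?_).mono ?_ ?_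
    · intro t ht s' h₁ h₂ h₃
      cases κ with
      | fwd =>
        simp only [seedBitE, NExp.eval, eval_reg, h₃, h₁.nat 10 (by decide), hc₁.i_eq, Kind.seed,
          Finset.mem_singleton]
        omega
      | bwd => simp [seedBitE, NExp.eval, Kind.seed]
      | full => simp [seedBitE, NExp.eval, Kind.seed]
    · have : (seedBitE κ).cost ≤ 15 := by cases κ <;> decide
      nlinarith
    · rintro s' ⟨h₁, h₂, h₃⟩
      have h4 := h₁.nat 4 (by decide)
      have h4' := h₁.real 4 (by decide)
      refine ⟨?_, ⟨fun x hx => ?_, fun x hx => ?_, fun x hx => ?_⟩, ?_⟩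
      · exact (ha₁.weaken (by simp) (by simp)).trans (h₁.weaken (by simp) (by simp))
      · rw [h4, hs₁]; simp [Function.update_of_ne hx.ne]
      · rw [h4', hs₁]; simp [Function.update_of_ne hx.ne]
      · rw [h₂ x hx, ha₁.nat 5 (by decide)]
      · unfold CellOK
        rw [h4, h4', hs₁]
        simp only [State.setReal_nat, State.setNat_nat, State.setReal_real, if_true,
          Function.update_self]
        have huniq : ∀ T, Sol D n κ i i m T → T = κ.seed i ∧ (κ = .fwd → 1 ≤ m ∧ i < n) := by
          intro T hT
          cases hT with
          | base _ _ _ h => exact ⟨rfl, h⟩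
          | join hil hlj => omega
        refine ⟨fun h0 T hT => hflag.2.2 (huniq T hT).2 h0, fun h0 => ?_⟩
        exact ⟨κ.seed i, .base κ i m (hflag.2.1 h0), rfl, fun T hT => by rw [(huniq T hT).1], h₃⟩
  · have : (seedFlagE κ).cost ≤ 30 ∧ (seedWeightE κ).cost ≤ 30 := by cases κ <;> decide
    simp only [reg, NExp.cost]
    omega

theorem runs_fillCell {κ : Kind} {i j m : ℕ} {s : State} (hW : cells n k * (n + 1) ≤ W)
    (henv : Env D wt n k s) (hc : AtCell n k κ i j m s)
    (hok : CellsOK D wt n k (cellNo n k κ i j m) s) :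
    Runs W (fillCell κ) s (3100 * ((n + 1) * (k + 1))) (Filled D wt n k κ i j m s) := by
  refine Runs.mono (Runs.branch (T := 200 * (n + 1)) (T' := 3000 * ((n + 1) * (k + 1)))
    (fun hb => ?_) fun hb => ?_) ?_ fun s' h => h
  · simp only [BExp.Holds, eval_reg, hc.i_eq, hc.j_eq] at hb
    obtain rfl : i = j := by omega
    exact runs_seedCell hW henv hc
  · simp only [BExp.Holds, eval_reg, hc.i_eq, hc.j_eq] at hb
    exact runs_joinCell hW henv hc hok (by omega)
  · simp only [BExp.cost, reg, NExp.cost]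
    have : n + 1 ≤ (n + 1) * (k + 1) := by nlinarith
    omega

end Fill

section Fill

variable {D : ℕ → ℕ → Prop} {wt : ℕ → ℝ} {n k W : ℕ}

theorem CellsOK.of_filled {κ : Kind} {i j m : ℕ} {s s' : State}
    (h : CellsOK D wt n k (cellNo n k κ i j m) s) (hf : Filled D wt n k κ i j m s s')
    (hi : i ≤ n) (hj : j ≤ n) (hm : m ≤ k) :
    CellsOK D wt n k (cellNo n k κ i j m + 1) s' := by
  intro κ' i' j' m' hi' hj' hm' hlt
  rcases Nat.lt_succ_iff_lt_or_eq.1 hlt with hlt | heq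
  · exact (h κ' i' j' m' hi' hj' hm' hlt).of_sameBelow hf.same hlt
  · obtain ⟨rfl, rfl, rfl, rfl⟩ := cellNo_injective hi' hi hj' hj hm' hm heq
    exact hf.ok

/-- Decoding of cell numbers. -/
theorem exists_cellNo_eq {c : ℕ} (hc : c < cells n k) : ∃ κ : Kind, κ.code = c / (k + 1) % 3 ∧
    c / (k + 1) / 3 / (n + 1) ≤ n ∧
    cellNo n k κ (n - c / (k + 1) / 3 / (n + 1)) (c / (k + 1) / 3 % (n + 1)) (c % (k + 1)) = c := by
  have h₁ : c / (k + 1) < (n + 1) * (n + 1) * 3 :=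
    Nat.div_lt_of_lt_mul (by rw [Nat.mul_comm]; exact hc)
  have h₂ : c / (k + 1) / 3 < (n + 1) * (n + 1) := by omega
  have h₃ : c / (k + 1) / 3 / (n + 1) < n + 1 := Nat.div_lt_of_lt_mul h₂
  have h₄ : c / (k + 1) % 3 < 3 := Nat.mod_lt _ (by omega)
  obtain ⟨κ, hκ⟩ : ∃ κ : Kind, κ.code = c / (k + 1) % 3 := by
    rcases (show c / (k + 1) % 3 = 0 ∨ c / (k + 1) % 3 = 1 ∨ c / (k + 1) % 3 = 2 by omega) with
      h | h | h
    · exact ⟨.fwd, h.symm⟩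
    · exact ⟨.bwd, h.symm⟩
    · exact ⟨.full, h.symm⟩
  refine ⟨κ, hκ, by omega, ?_⟩
  unfold cellNo
  rw [Nat.sub_sub_self (by omega), Nat.div_add_mod', hκ, Nat.div_add_mod', Nat.div_add_mod']

theorem runs_decodeAndFill {c : ℕ} {s : State} (hW : cells n k * (n + 1) ≤ W)
    (henv : Env D wt n k s) (hc : s.nat 6 0 = c) (hlt : c < cells n k)
    (hok : CellsOK D wt n k c s) :
    Runs W decodeAndFill s (3200 * ((n + 1) * (k + 1))) fun s' => s'.nat 6 0 = c ∧
      Agree [4, 5, 7, 8, 9, 10, 11, 12, 13, 14] [4] s s' ∧ CellsOK D wt n k (c + 1) s' := by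
  have hle := le_cells (n := n) (k := k)
  have hk : k < (n + 1) * (k + 1) := by nlinarith
  have hW₁ : cells n k ≤ W := by
    rw [Nat.mul_add_one] at hW; have := Nat.zero_le (cells n k * n); omega
  obtain ⟨κ, hκ, hi, hcell⟩ := exists_cellNo_eq hlt
  have hm : c % (k + 1) ≤ k := Nat.lt_succ_iff.1 (Nat.mod_lt _ (by omega))
  have hj : c / (k + 1) / 3 % (n + 1) ≤ n := Nat.lt_succ_iff.1 (Nat.mod_lt _ (by omega))
  have hq : c / (k + 1) ≤ c := Nat.div_le_self _ _
  generalize hqe : c / (k + 1) = q at *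
  generalize hme : c % (k + 1) = m at *
  generalize hje : q / 3 % (n + 1) = j at *
  obtain ⟨i, hie⟩ : ∃ i, i = n - q / 3 / (n + 1) := ⟨_, rfl⟩
  have hin : i ≤ n := hie ▸ Nat.sub_le _ _
  rw [← hie] at hcell
  obtain ⟨s₁, hs₁⟩ : ∃ s₁, s₁ = (((s.setNat 7 0 m).setNat 8 0 q).setNat 9 0 j).setNat 10 0 i :=
    ⟨_, rfl⟩
  have ha₁ : Agree [7, 8, 9, 10] [] s s₁ := by
    rw [hs₁]
    exact (((Agree.refl.setNat (by decide) _ _).setNat (by decide) _ _).setNat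
      (by decide) _ _).setNat (by decide) _ _
  have henv₁ := henv.of_agree ha₁
  have hc₁ : AtCell n k κ i j m s₁ := by
    refine ⟨hin, hj, hm, ?_, ?_, ?_, ?_⟩ <;> simp [hs₁, hc, hcell]
  have hok₁ : CellsOK D wt n k (cellNo n k κ i j m) s₁ := by
    rw [hcell]
    intro κ' i' j' m' h₁ h₂ h₃ h₄
    refine (hok κ' i' j' m' h₁ h₂ h₃ h₄).of_sameBelow ⟨?_, ?_, ?_⟩ h₄ <;> simp [hs₁]
  have hfill : Runs W (fillCell κ) s₁ (3100 * ((n + 1) * (k + 1))) fun s' => s'.nat 6 0 = c ∧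
      Agree [4, 5, 7, 8, 9, 10, 11, 12, 13, 14] [4] s s' ∧ CellsOK D wt n k (c + 1) s' := by
    refine (runs_fillCell hW henv₁ hc₁ hok₁).mono le_rfl fun s' h => ⟨?_, ?_, ?_⟩
    · rw [h.agree.nat 6 (by decide), ha₁.nat 6 (by decide), hc]
    · exact (ha₁.weaken (by simp) (by simp)).trans (h.agree.weaken (by simp) (by simp))
    · rw [← hcell]; exact hok₁.of_filled h hc₁.i_le hj hm
  have h8 : (modE (reg 8) (.const 3)).eval s₁ = κ.code := by
    rw [eval_modE, hκ]; simp [NExp.eval, eval_reg, hs₁]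
  have hselect : Runs W (.branch (.natLe (modE (reg 8) (.const 3)) (.const 0)) (fillCell .fwd)
      (.branch (.natLe (modE (reg 8) (.const 3)) (.const 1)) (fillCell .bwd)
        (fillCell .full))) s₁ (3100 * ((n + 1) * (k + 1)) + 30) fun s' => s'.nat 6 0 = c ∧
      Agree [4, 5, 7, 8, 9, 10, 11, 12, 13, 14] [4] s s' ∧ CellsOK D wt n k (c + 1) s' := by
    refine Runs.mono (Runs.branch (T := 3100 * ((n + 1) * (k + 1))) (fun hb => ?_) fun hb =>
      Runs.branch (T := 3100 * ((n + 1) * (k + 1))) (T' := 3100 * ((n + 1) * (k + 1)))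
        (fun hb' => ?_) fun hb' => ?_) ?_ fun s' h => h
    · simp only [BExp.Holds, h8, NExp.eval] at hb
      cases κ <;> simp [Kind.code] at hb
      exact hfill
    · simp only [BExp.Holds, h8, NExp.eval] at hb hb'
      cases κ <;> simp [Kind.code] at hb hb'
      exact hfill
    · simp only [BExp.Holds, h8, NExp.eval] at hb hb'
      cases κ <;> simp [Kind.code] at hb hb'
      exact hfill
    · simp only [BExp.cost, modE, reg, NExp.cost]; omega
  refine Runs.mono (Runs.seq <| Runs.natStore (i := .const 0) ?_ ?_ <| Runs.seq <|
    Runs.natStore (i := .const 0) ?_ ?_ <| Runs.seq <| Runs.natStore (i := .const 0) ?_ ?_ <|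
    Runs.seq (T' := 3100 * ((n + 1) * (k + 1)) + 30) <|
    Runs.natStore (i := .const 0) ?_ ?_ ?_) ?_ fun s' h => h
  all_goals try simp only [NExp.eval, eval_modE, eval_reg, nE, kE, henv.k_eq, hc,
    State.setNat_nat, hme]
  all_goals try simp [henv.n_eq, henv.k_eq, hc, hqe, hje, ← hie]
  any_goals omega
  · rw [← hs₁]; exact hselect
  · simp only [modE, reg, NExp.cost]; omega

theorem runs_fillLoop {s : State} (hW : cells n k * (n + 1) ≤ W) (hW₁ : cells n k < W)
    (henv : Env D wt n k s) :
    Runs W fillLoop s (cells n k * (3300 * ((n + 1) * (k + 1))) + 50) fun s' =>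
      Agree [4, 5, 6, 7, 8, 9, 10, 11, 12, 13, 14] [4] s s' ∧
        CellsOK D wt n k (cells n k) s' := by
  have hle := le_cells (n := n) (k := k)
  refine Runs.mono (Runs.forLoop (T := 3200 * ((n + 1) * (k + 1))) (N := cells n k) (fun c s' =>
    Agree [4, 5, 6, 7, 8, 9, 10, 11, 12, 13, 14] [4] s s' ∧ CellsOK D wt n k c s') hW₁
    ?_ ?_ ?_ fun s' h => h) ?_ fun s' h => h
  · rintro c s' ⟨h, -⟩ -
    have := henv.of_agree h
    simp only [NExp.eval, nE, kE, this.n_eq, this.k_eq, cells]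
  · exact ⟨Agree.refl.setNat (by decide) _ _, fun _ _ _ _ _ _ _ h => absurd h (Nat.not_lt_zero _)⟩
  · rintro c hc s' ⟨ha, hok⟩ h6
    refine (runs_decodeAndFill hW (henv.of_agree ha) h6 hc hok).mono le_rfl ?_
    rintro s'' ⟨h6', ha', hok'⟩
    refine ⟨h6', (ha.trans (ha'.weaken (by simp) (by simp))).setNat (by decide) _ _, ?_⟩
    intro κ i j m hi hj hm hlt
    exact (hok' κ i j m hi hj hm hlt).of_sameBelow
      (⟨by simp, by simp, by simp⟩ : SameBelow n (c + 1) s'' _) hlt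
  · simp only [NExp.cost, nE, kE]
    have : cells n k * (3200 * ((n + 1) * (k + 1)) + 40) ≤
        cells n k * (3300 * ((n + 1) * (k + 1))) := by
      refine Nat.mul_le_mul_left _ ?_
      have : 1 ≤ (n + 1) * (k + 1) := Nat.one_le_iff_ne_zero.2 (by positivity)
      omega
    nlinarith

end Fill

end RealRAM

/-! ### Sorting the points and writing the output -/

namespace RealRAM

section Sorting

variable {n W : ℕ}

/-- The point with index `u` in the memory `s`. -/
noncomputable def State.point (s : State) (u : ℕ) : Plane := !₂[s.real 0 u, s.real 1 u]

theorem holds_orientPosE (s : State) : orientPosE.Holds s ↔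
    0 < orient (s.point 0) (s.point (s.nat 16 0)) (s.point (s.nat 15 0)) := by
  simp [orientPosE, BExp.Holds, RExp.eval, NExp.eval, reg, orient, State.point]

open Classical in
theorem runs_countLoop {x : ℕ} {s : State} (hW : n + 1 < W) (hn : s.nat 0 0 = n)
    (hx : s.nat 15 0 = x) (hxn : x < n) (h17 : s.nat 17 0 = 1 - (1 - x)) :
    Runs W (forLoop 16 nE
      (.branch orientPosE (.natStore 17 (.const 0) (.add (reg 17) (.const 1))) .skip)) s
      (n * 80 + 20) fun s' => Agree [16, 17] [] s s' ∧ s'.nat 17 0 = polygonRank s.point n x := by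
  refine Runs.mono (Runs.forLoop (T := 60) (N := n) (fun y s' => Agree [16, 17] [] s s' ∧
    s'.nat 17 0 = (1 - (1 - x)) + ((Finset.range y).filter fun b =>
      0 < orient (s.point 0) (s.point b) (s.point x)).card) (by omega)
    (fun y s' h _ => by simp [nE, NExp.eval, h.1.nat 0 (by decide), hn])
    ⟨Agree.refl.setNat (by decide) _ _, by simp [h17]⟩ ?_ fun s' h => h) ?_ ?_
  · rintro y hy s' ⟨h₁, h₂⟩ h16
    have hpt : s'.point = s.point := by
      ext u; simp [State.point, h₁.real 0 (by decide), h₁.real 1 (by decide)]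
    have hcard := Finset.card_filter_le (Finset.range y)
      fun b => 0 < orient (s.point 0) (s.point b) (s.point x)
    rw [Finset.card_range] at hcard
    have hholds := holds_orientPosE s'
    rw [h16, hpt, h₁.nat 15 (by decide), hx] at hholds
    refine Runs.mono (Runs.branch (T := 6) (T' := 1) (fun hb => ?_) fun hb => ?_) ?_ fun s' h => h
    · rw [hholds] at hb
      refine Runs.natStore ?_ ?_ ⟨?_, ?_, ?_⟩
      · simp only [NExp.eval]; omega
      · simp only [NExp.eval, eval_reg, h₂]; omega
      · simpa using h16
      · exact (h₁.setNat (by decide) _ _).setNat (by decide) _ _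
      · simp [NExp.eval, eval_reg, h₂, Finset.range_add_one, Finset.filter_insert, hb]
        omega
    · rw [hholds] at hb
      refine Runs.skip ⟨h16, h₁.setNat (by decide) _ _, ?_⟩
      simp [h₂, Finset.range_add_one, Finset.filter_insert, hb]
    · decide
  · simp only [nE, NExp.cost]; omega
  · rintro s' ⟨h₁, h₂⟩
    refine ⟨h₁, ?_⟩
    rw [h₂, polygonRank_eq _ hxn]

theorem runs_sortLoop {s : State} (hW : n + 1 < W) (hn : s.nat 0 0 = n)
    (hP : ConvexBelow s.point n) :
    Runs W sortLoop s (n * (n * 80 + 100) + 20) fun s' => Agree [3, 15, 16, 17] [] s s' ∧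
      ∀ a < n, s'.nat 3 (polygonRank s.point n a) = a := by
  refine Runs.mono (Runs.forLoop (T := n * 80 + 50) (N := n) (fun x s' =>
    Agree [3, 15, 16, 17] [] s s' ∧ ∀ a < x, s'.nat 3 (polygonRank s.point n a) = a) (by omega)
    (fun y s' h _ => by simp [nE, NExp.eval, h.1.nat 0 (by decide), hn])
    ⟨Agree.refl.setNat (by decide) _ _, by simp⟩ ?_ fun s' h => h) ?_ fun s' h => h
  · rintro x hx s' ⟨h₁, h₂⟩ h15
    have hpt : s'.point = s.point := by
      ext u; simp [State.point, h₁.real 0 (by decide), h₁.real 1 (by decide)]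
    have hsign := eval_signE_le s' (reg 15)
    refine Runs.mono (Runs.seq <| Runs.natStore ?_ ?_ <| Runs.seq <|
      (runs_countLoop (n := n) (x := x) hW ?_ ?_ hx ?_).mono
        (Q' := fun s'' => Runs W (.natStore 3 (reg 17) (reg 15)) s'' 5 fun s' =>
          s'.nat 15 0 = x ∧ Agree [3, 15, 16, 17] [] s (s'.setNat 15 0 (x + 1)) ∧
            ∀ a < x + 1, (s'.setNat 15 0 (x + 1)).nat 3 (polygonRank s.point n a) = a)
        le_rfl ?_) ?_ fun s' h => h
    · simp only [NExp.eval]; omega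
    · omega
    · simp [h₁.nat 0 (by decide), hn]
    · simpa using h15
    · simp [signE, NExp.eval, eval_reg, h15]
    · rintro s'' ⟨h₃, h₄⟩
      have hpt' : (s'.setNat 17 ((NExp.const 0).eval s') ((signE (reg 15)).eval s')).point =
          s.point := hpt
      rw [hpt'] at h₄
      have h15'' : s''.nat 15 0 = x := by rw [h₃.nat 15 (by decide)]; simpa using h15
      have hrank := polygonRank_lt (P := s.point) hx
      have ha : Agree [3, 15, 16, 17] [] s s'' :=
        (h₁.setNat (by decide) _ _).trans (h₃.weaken (by simp) (by simp))
      refine Runs.natStore ?_ ?_ ⟨by simpa using h15'', ?_, ?_⟩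
      · rw [eval_reg]; omega
      · rw [eval_reg]; omega
      · exact (ha.setNat (by decide) _ _).setNat (by decide) _ _
      · intro a ha'
        simp only [eval_reg, State.setNat_nat, h₄, h15'']
        rcases Nat.lt_succ_iff_lt_or_eq.1 ha' with h | rfl
        · have hne : polygonRank s.point n a ≠ polygonRank s.point n x := fun h' => by
            have := hP.rank_injOn (show a < n by omega) hx h'
            omega
          have h3 : s''.nat 3 = s'.nat 3 := by rw [h₃.nat 3 (by decide)]; simp
          simp [Function.update_of_ne hne, h3, h₂ a h]
        · simp
    · simp only [signE, reg, NExp.cost]; omega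
  · simp only [nE, NExp.cost]
    nlinarith

end Sorting

section Output

variable {D : ℕ → ℕ → Prop} {wt : ℕ → ℝ} {n k W : ℕ} {P : ℕ → Plane}

theorem runs_outputLoop {s : State} (hW : n + 1 < W) (henv : Env D wt n k s)
    (hP : ConvexBelow P n) (hpos : ∀ a < n, s.nat 3 (polygonRank P n a) = a) :
    Runs W outputLoop s (n * 200 + 200) fun s' =>
      (s'.nat 1 0 ≠ 0 ↔ s.nat 4 (cellNo n k .full 0 n k) ≠ 0) ∧
      ∀ a < n, (s'.nat 2 a ≠ 0 ↔
        s.nat 5 (cellNo n k .full 0 n k * n + polygonRank P n a) ≠ 0) := by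
  have hlast : lastE.eval s = cellNo n k .full 0 n k := by
    rw [lastE, henv.eval_cellE]
    simp only [NExp.eval, nE, kE, henv.n_eq, henv.k_eq]
  have hlast4 : (NExp.get 4 lastE).eval s = s.nat 4 (cellNo n k .full 0 n k) := by
    simp only [NExp.eval, hlast]
  have hsign := eval_signE_le s (.get 4 lastE)
  have hsign' := eval_signE_ne_zero s (.get 4 lastE)
  rw [hlast4] at hsign'
  obtain ⟨f, hf⟩ : ∃ f, f = (signE (.get 4 lastE)).eval s := ⟨_, rfl⟩
  rw [← hf] at hsign hsign'
  obtain ⟨s₁, hs₁⟩ : ∃ s₁, s₁ = s.setNat 1 0 f := ⟨_, rfl⟩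
  have ha₁ : Agree [1] [] s s₁ := hs₁ ▸ Agree.refl.setNat (by decide) _ _
  have hloop : Runs W (forLoop 14 nE (.natStore 2 (.get 3 (reg 14)) (signE (.get 5 (bitE lastE)))))
      s₁ (n * 100 + 20) fun s' => Agree [2, 14] [] s₁ s' ∧ ∀ a < n, (s'.nat 2 a ≠ 0 ↔
        s.nat 5 (cellNo n k .full 0 n k * n + polygonRank P n a) ≠ 0) := by
    refine Runs.mono (Runs.forLoop (T := (NExp.get 3 (reg 14)).cost +
      (signE (.get 5 (bitE lastE))).cost + 1) (N := n) (fun t s' => Agree [2, 14] [] s₁ s' ∧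
      ∀ a < n, polygonRank P n a < t → (s'.nat 2 a ≠ 0 ↔
        s.nat 5 (cellNo n k .full 0 n k * n + polygonRank P n a) ≠ 0)) (by omega)
      (fun t s' h _ => ?_) ⟨Agree.refl.setNat (by decide) _ _, by simp⟩ ?_
      fun s' h => h) ?_ ?_
    · exact ((henv.of_agree ha₁).of_agree h.1).n_eq
    · rintro t ht s' ⟨h₁, h₂⟩ h14
      have henv' := (henv.of_agree ha₁).of_agree h₁
      obtain ⟨x, hx, rfl⟩ := hP.exists_rank_eq ht
      have hi : (NExp.get 3 (reg 14)).eval s' = x := by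
        simp only [NExp.eval, eval_reg, h14, h₁.nat 3 (by decide), ha₁.nat 3 (by decide), hpos x hx]
      have hlast' : lastE.eval s' = cellNo n k .full 0 n k := by
        rw [lastE, henv'.eval_cellE]
        simp only [NExp.eval, nE, kE, henv'.n_eq, henv'.k_eq]
      have hbit : (NExp.get 5 (bitE lastE)).eval s' =
          s.nat 5 (cellNo n k .full 0 n k * n + polygonRank P n x) := by
        simp only [bitE, NExp.eval, hlast', nE, eval_reg, h14, henv'.n_eq, h₁.nat 5 (by decide),
          ha₁.nat 5 (by decide)]
      have hle := eval_signE_le s' (.get 5 (bitE lastE))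
      have hne := eval_signE_ne_zero s' (.get 5 (bitE lastE))
      rw [hbit] at hne
      refine Runs.natStore ?_ ?_ ⟨by simpa using h14, ?_, ?_⟩
      · omega
      · omega
      · exact (h₁.setNat (by decide) _ _).setNat (by decide) _ _
      · intro a ha hlt
        rw [hi]
        by_cases hax : a = x
        · subst hax
          simpa using hne
        · have : polygonRank P n a ≠ polygonRank P n x := fun h => hax (hP.rank_injOn ha hx h)
          simpa [Function.update_of_ne hax] using h₂ a ha (by omega)
    · have : (NExp.get 3 (reg 14)).cost + (signE (.get 5 (bitE lastE))).cost ≤ 60 := by decide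
      rw [show nE.cost = 2 from rfl]
      nlinarith
    · exact fun s' h => ⟨h.1, fun a ha => h.2 a ha (polygonRank_lt ha)⟩
  refine Runs.mono (Runs.seq (T' := n * 100 + 20) <| Runs.natStore ?_ ?_ ?_) ?_ fun s' h => h
  · simp only [NExp.eval]; omega
  · omega
  · simp only [← hf]
    rw [show (NExp.const 0).eval s = 0 from rfl, ← hs₁]
    refine hloop.mono le_rfl fun s' h => ⟨?_, h.2⟩
    rw [h.1.nat 1 (by decide), hs₁]
    simpa using hsign'
  · have : (signE (NExp.get 4 lastE)).cost ≤ 60 := by decide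
    simp only [NExp.cost]; omega

end Output

end RealRAM

/-! ### Running time and correctness of the program -/

section Final

variable {n k : ℕ} {p : Fin n → EuclideanSpace ℝ (Fin 2)} {r w : Fin n → ℝ}

/-- Since radii are nonnegative, a vertex of `S` also satisfies the distance condition for itself. -/
theorem isDominatingSet_diskGraph_iff (hr : ∀ i, 0 ≤ r i) (S : Finset (Fin n)) :
    IsDominatingSet (diskGraph p r) S ↔ ∀ v, ∃ u ∈ S, dist (p v) (p u) ≤ r u + r v := by
  have hadj : ∀ u v, (Metric.closedBall (p v) (r v) ∩ Metric.closedBall (p u) (r u)).Nonempty ↔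
      dist (p v) (p u) ≤ r u + r v := by
    intro u v
    rw [← Set.not_disjoint_iff_nonempty_inter, disjoint_closedBall_closedBall_iff (hr v) (hr u),
      not_lt, add_comm]
  refine forall_congr' fun v => ⟨?_, ?_⟩
  · rintro (hv | ⟨u, hu, -, h⟩)
    · exact ⟨v, hv, by rw [dist_self]; linarith [hr v]⟩
    · exact ⟨u, hu, (hadj u v).1 h⟩
  · rintro ⟨u, hu, h⟩
    by_cases huv : v = u
    · exact .inl (huv ▸ hu)
    · exact .inr ⟨u, hu, huv, (hadj u v).2 h⟩

open RealRAM

theorem input_point (k : ℕ) (i : Fin n) : (input n k p r w).point i = p i := by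
  apply Plane.ext_coord <;> simp [State.point, input]

/-- The numbers of steps of the three phases add up to the required bound; since the dynamic program
needs no logarithmic factor, that factor is only bounded from below. -/
theorem steps_le (n k : ℕ) :
    ((n * (n * 80 + 100) + 20 + (cells n k * (3300 * ((n + 1) * (k + 1))) + 50 +
      (n * 200 + 200) + 1) + 1 : ℕ) : ℝ) ≤
    4000000 * ((max k 1 : ℕ) ^ 2 * (max n 2 : ℕ) ^ 3 * Real.log (max n 2 : ℕ) ^ 2) := by
  have hlog : 1 / 4 ≤ Real.log (max n 2 : ℕ) ^ 2 := by
    have h₁ : Real.log 2 ≤ Real.log (max n 2 : ℕ) :=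
      Real.log_le_log (by norm_num) (by exact_mod_cast le_max_right n 2)
    have h₂ := Real.log_two_gt_d9
    nlinarith
  have hsum : n * (n * 80 + 100) + 20 + (cells n k * (3300 * ((n + 1) * (k + 1))) + 50 +
      (n * 200 + 200) + 1) + 1 ≤ 10500 * ((n + 1) ^ 3 * (k + 1) ^ 2) := by
    have h₁ : (n + 1) ^ 2 ≤ (n + 1) ^ 3 * (k + 1) ^ 2 := by
      calc (n + 1) ^ 2 ≤ (n + 1) ^ 3 := Nat.pow_le_pow_right (by omega) (by omega)
        _ ≤ _ := Nat.le_mul_of_pos_right _ (by positivity)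
    have h₂ : cells n k * (3300 * ((n + 1) * (k + 1))) = 9900 * ((n + 1) ^ 3 * (k + 1) ^ 2) := by
      unfold cells; ring
    rw [h₂]
    generalize (n + 1) ^ 3 * (k + 1) ^ 2 = y at h₁ ⊢
    nlinarith
  have hbound : (n + 1) ^ 3 * (k + 1) ^ 2 ≤ 32 * ((max k 1) ^ 2 * (max n 2) ^ 3) := by
    calc (n + 1) ^ 3 * (k + 1) ^ 2 ≤ (2 * max n 2) ^ 3 * (2 * max k 1) ^ 2 :=
          Nat.mul_le_mul (Nat.pow_le_pow_left (by omega) 3) (Nat.pow_le_pow_left (by omega) 2)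
      _ = _ := by ring
  have hnat : (((n * (n * 80 + 100) + 20 + (cells n k * (3300 * ((n + 1) * (k + 1))) + 50 +
      (n * 200 + 200) + 1) + 1 : ℕ)) : ℝ) ≤
      336000 * ((max k 1 : ℕ) ^ 2 * (max n 2 : ℕ) ^ 3) := by
    exact_mod_cast hsum.trans (by omega)
  have hpos : (0 : ℝ) ≤ (max k 1 : ℕ) ^ 2 * (max n 2 : ℕ) ^ 3 := by positivity
  refine hnat.trans ?_
  have := mul_le_mul_of_nonneg_left hlog hpos
  linarith

/-- All addresses and all stored integers are less than `(n + k + 2) ^ 6`. -/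
theorem cells_mul_lt (n k : ℕ) : cells n k * (n + 1) ≤ (n + k + 2) ^ 6 ∧
    cells n k < (n + k + 2) ^ 6 ∧ n + 1 < (n + k + 2) ^ 6 := by
  have hM : 2 ≤ n + k + 2 := by omega
  have h3 : cells n k * (n + 1) < (n + k + 2) ^ 6 := by
    calc cells n k * (n + 1) = (n + 1) ^ 3 * 3 * (k + 1) := by unfold cells; ring
      _ < (n + k + 2) ^ 3 * (n + k + 2) ^ 2 * (n + k + 2) := by
          have h₁ : (n + 1) ^ 3 ≤ (n + k + 2) ^ 3 := Nat.pow_le_pow_left (by omega) 3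
          have h₂ : 3 ≤ (n + k + 2) ^ 2 := by nlinarith
          exact Nat.mul_lt_mul_of_le_of_lt (Nat.mul_le_mul h₁ h₂) (by omega) (by positivity)
      _ = _ := by ring
  have h₁ : cells n k ≤ cells n k * (n + 1) := Nat.le_mul_of_pos_right _ (by omega)
  have h₂ := (le_cells (n := n) (k := k)).1
  omega

/-- What the solution in the last cell says about the disk graph. -/
theorem isCorrectAnswer_of_cellOK {s : State} {P : ℕ → Plane} {R : ℕ → ℝ} {pos : ℕ → ℕ}
    {wt : ℕ → ℝ} (hP : ConvexBelow P n) (hpP : ∀ i : Fin n, P i = p i) (hR : ∀ u, 0 ≤ R u)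
    (hRr : ∀ i : Fin n, R i = r i) (hr : ∀ i, 0 ≤ r i) (hw : ∀ i, 0 < w i)
    (hpos : ∀ a < n, pos (polygonRank P n a) = a) (hwt : ∀ u, ∀ i : Fin n, pos u = i → wt u = w i)
    (hok : CellOK (Meets (fun u => P (pos u)) (fun u => R (pos u))) wt n k s .full 0 n k)
    {o : Option (Finset (Fin n))}
    (hnone : s.nat 4 (cellNo n k .full 0 n k) = 0 → o = none)
    (hsome : s.nat 4 (cellNo n k .full 0 n k) ≠ 0 → ∃ O, o = some O ∧ ∀ a, a ∈ O ↔
      s.nat 5 (cellNo n k .full 0 n k * n + polygonRank P n a) ≠ 0) :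
    IsCorrectAnswer (diskGraph p r) w k o := by
  classical
  have hinj : Set.InjOn (fun a : Fin n => polygonRank P n a) Set.univ := fun a _ b _ h =>
    Fin.ext (hP.rank_injOn a.2 b.2 h)
  have hsum : ∀ T : Finset (Fin n),
      ∑ u ∈ T.image (fun a : Fin n => polygonRank P n a), wt u = ∑ a ∈ T, w a := by
    intro T
    rw [Finset.sum_image fun a _ b _ h => hinj trivial trivial h]
    exact Finset.sum_congr rfl fun a _ => hwt _ a (hpos a a.2)
  -- a dominating set contains one whose positions are found by the recursion
  have hsol : ∀ T : Finset (Fin n), IsDominatingSet (diskGraph p r) T → T.card ≤ k →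
      ∃ U, Sol (Meets (fun u => P (pos u)) (fun u => R (pos u))) n .full 0 n k U ∧
        ∑ u ∈ U, wt u ≤ ∑ a ∈ T, w a := by
    intro T hT hcard
    rw [isDominatingSet_diskGraph_iff hr] at hT
    obtain ⟨U, hU, hsol⟩ := exists_sol_subset (n := n) (Q := fun u => P (pos u))
      (R := fun u => R (pos u)) (S := T.image fun a : Fin n => polygonRank P n a)
      (fun v => by unfold Meets; rw [dist_self]; linarith [hR (pos v)])
      (fun a b c d h₁ h₂ h₃ h₄ => hP.chords_meet hpos h₁ h₂ h₃ h₄)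
      (fun u hu => by
        obtain ⟨a, -, rfl⟩ := Finset.mem_image.1 hu
        exact polygonRank_lt a.2)
      (fun v hv => by
        obtain ⟨b, hb, rfl⟩ := hP.exists_rank_eq hv
        obtain ⟨a, ha, h⟩ := hT ⟨b, hb⟩
        refine ⟨_, Finset.mem_image_of_mem _ ha, ?_⟩
        unfold Meets
        simp only [hpos a a.2, hpos b hb, hpP, hRr]
        have h₁ := hpP ⟨b, hb⟩
        have h₂ := hRr ⟨b, hb⟩
        simp only at h₁ h₂
        rwa [h₁, h₂])
    refine ⟨U, hsol.mono ((Finset.card_le_card hU).trans (Finset.card_image_le.trans hcard)), ?_⟩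
    rw [← hsum]
    refine Finset.sum_le_sum_of_subset_of_nonneg hU fun u hu _ => ?_
    obtain ⟨a, -, rfl⟩ := Finset.mem_image.1 hu
    rw [hwt _ a (hpos a a.2)]
    exact (hw a).le
  by_cases hflag : s.nat 4 (cellNo n k .full 0 n k) = 0
  · rw [hnone hflag]
    intro T hT hcard
    obtain ⟨U, hU, -⟩ := hsol T hT hcard
    exact hok.1 hflag U hU
  · obtain ⟨O, rfl, hO⟩ := hsome hflag
    obtain ⟨S, hS, hwS, hmin, hbit⟩ := hok.2 hflag
    have hOS : O.image (fun a : Fin n => polygonRank P n a) = S := by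
      ext u
      rw [Finset.mem_image]
      constructor
      · rintro ⟨a, ha, rfl⟩
        exact (hbit _ (polygonRank_lt a.2)).1 ((hO a).1 ha)
      · intro hu
        obtain ⟨a, ha, rfl⟩ := hP.exists_rank_eq (hS.bounds u hu).2
        exact ⟨⟨a, ha⟩, (hO ⟨a, ha⟩).2 ((hbit _ (polygonRank_lt ha)).2 hu), rfl⟩
    refine ⟨⟨?_, ?_⟩, fun T hT hcard => ?_⟩
    · rw [isDominatingSet_diskGraph_iff hr]
      intro v
      obtain ⟨u, hu, h⟩ := hS.served _ (Nat.zero_le _) (polygonRank_lt (P := P) v.2)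
      rw [← hOS, Finset.mem_image] at hu
      obtain ⟨a, ha, rfl⟩ := hu
      unfold Meets at h
      simp only [hpos a a.2, hpos v v.2, hpP, hRr] at h
      exact ⟨a, ha, h⟩
    · rw [← Finset.card_image_of_injOn (hinj.mono (Set.subset_univ _)), hOS]
      exact hS.card_le
    · obtain ⟨U, hU, hle⟩ := hsol T hT hcard
      rw [← hsum, hOS, ← hwS]
      exact (hmin U hU).trans hle

theorem mainTheorem1 :
    ∃ (prog : RealRAM.Program) (C : ℝ) (d : ℕ),
      ∀ (n k : ℕ) (p : Fin n → EuclideanSpace ℝ (Fin 2)) (r w : Fin n → ℝ),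
        ConvexIndependent ℝ p → (∀ i, 0 ≤ r i) → (∀ i, 0 < w i) →
        ∃ (t : ℕ) (s : RealRAM.State),
          RealRAM.Exec ((n + k + 2) ^ d) prog (RealRAM.input n k p r w) t s ∧
          IsCorrectAnswer (diskGraph p r) w k (RealRAM.output n s) ∧
          (t : ℝ) ≤ C * ((max k 1 : ℕ) ^ 2 * (max n 2 : ℕ) ^ 3 *
            Real.log (max n 2 : ℕ) ^ 2) := by
  refine ⟨dominatingSetProgram, 4000000, 6, fun n k p r w hp hr hw => ?_⟩
  obtain ⟨s₀, hs₀⟩ : ∃ s₀, s₀ = input n k p r w := ⟨_, rfl⟩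
  rw [← hs₀]
  obtain ⟨hW₁, hW₂, hW₃⟩ := cells_mul_lt n k
  have hpP : ∀ i : Fin n, s₀.point i = p i := fun i => hs₀ ▸ input_point k i
  have hP : ConvexBelow s₀.point n := by
    unfold ConvexBelow
    rwa [show (fun i : Fin n => s₀.point i) = p from funext hpP]
  have hR : ∀ u, 0 ≤ s₀.real 2 u := by
    intro u
    subst hs₀
    by_cases h : u < n
    · simpa [input, h] using hr _
    · simp [input, h]
  have hRr : ∀ i : Fin n, s₀.real 2 i = r i := fun i => by simp [hs₀, input]
  have hn₀ : s₀.nat 0 0 = n := by simp [hs₀, input]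
  have hk₀ : s₀.nat 0 1 = k := by simp [hs₀, input]
  have henv : ∀ s₁, Agree [3, 15, 16, 17] [] s₀ s₁ →
      Env (Meets (fun u => s₀.point (s₁.nat 3 u)) (fun u => s₀.real 2 (s₁.nat 3 u)))
        (fun u => s₀.real 3 (s₁.nat 3 u)) n k s₁ := by
    intro s₁ ha
    refine ⟨?_, ?_, fun u v => ?_, fun u => ?_⟩
    · rw [ha.nat 0 (by decide), hn₀]
    · rw [ha.nat 0 (by decide), hk₀]
    · rw [ha.real 0 (by decide), ha.real 1 (by decide), ha.real 2 (by decide)]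
      unfold Meets
      rw [EuclideanSpace.dist_eq, Fin.sum_univ_two,
        Real.sqrt_le_left (add_nonneg (hR _) (hR _)), Real.dist_eq, Real.dist_eq, sq_abs, sq_abs]
      simp only [State.point]
      rw [← sub_nonneg, ← sub_nonneg (b := _ * _ + _ * _)]
      simp
      ring_nf
    · rw [ha.real 3 (by decide)]
  have hrun : Runs ((n + k + 2) ^ 6) dominatingSetProgram s₀
      (n * (n * 80 + 100) + 20 + (cells n k * (3300 * ((n + 1) * (k + 1))) + 50 +
        (n * 200 + 200) + 1) + 1)
      fun s => IsCorrectAnswer (diskGraph p r) w k (output n s) := by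
    refine Runs.seq ((runs_sortLoop hW₃ hn₀ hP).mono le_rfl fun s₁ h₁ => ?_)
    obtain ⟨ha₁, hpos⟩ := h₁
    have henv₁ := henv s₁ ha₁
    refine Runs.seq ((runs_fillLoop hW₁ hW₂ henv₁).mono le_rfl fun s₂ h₂ => ?_)
    obtain ⟨ha₂, hok⟩ := h₂
    have hpos₂ : ∀ a < n, s₂.nat 3 (polygonRank s₀.point n a) = a := by
      rwa [ha₂.nat 3 (by decide)]
    refine (runs_outputLoop hW₃ (henv₁.of_agree ha₂) hP hpos₂).mono le_rfl fun s₃ h₃ => ?_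
    refine isCorrectAnswer_of_cellOK hP hpP hR hRr hr hw hpos (fun u i hu => ?_)
      (hok .full 0 n k (Nat.zero_le _) le_rfl le_rfl (cellNo_lt le_rfl le_rfl)) (fun h => ?_)
      fun h => ?_
    · simp [hu, hs₀, input]
    · have : s₃.nat 1 0 = 0 := by by_contra h'; exact h₃.1.1 h' h
      simp [output, this]
    · refine ⟨_, if_neg (h₃.1.2 h), fun a => ?_⟩
      rw [Finset.mem_filter]
      exact ⟨fun ha => (h₃.2 a a.2).1 ha.2, fun ha => ⟨Finset.mem_univ _, (h₃.2 a a.2).2 ha⟩⟩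
  obtain ⟨t, s, hexec, ht, hans⟩ := hrun
  exact ⟨t, s, hexec, hans, le_trans (by exact_mod_cast ht) (steps_le n k)⟩

end Final
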